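/- Let $k$ be a commutative artinian ring and let $A$ be an Artin $k$-algebra (i.e. finitely generated as a $k$-module) which is connected ($A\neq 0$, and $0,1$ are the only central idempotents) and Nakayama (every finitely generated indecomposable projective left or right $A$-module is uniserial). Let $S_1,\dots,S_n$ be a complete set of pairwise non-isomorphic simple left $A$-modules and let $P(S_i)$ be the projective cover of $S_i$. The Cartan matrix $\mathbf C_A=(c_{ij})$ is the $n\times n$ matrix in which $c_{ij}$ is the number of copies of $S_i$ in a composition series of $P(S_j)$. The resolution quiver of $A$ has vertices $S_1,\dots,S_n$ and an arrow $S_i\to S_j$ if and only if $S_j\cong\tilde\tau(\operatorname{soc}P(S_i))$; here, for a simple module $S$, $\tilde\tau(S)$ is the Auslander–Reiten translate $\tau(S)=D\operatorname{Tr}S$ if $S$ is not projective, and the (up to isomorphism unique) simple injective $A$-module if $S$ is projective. The weight of a cycle $C$ of the resolution quiver is $w(C)=\frac1n\sum_{S\in C}\ell(P(S))$, where $\ell$ is the composition length; $C$ is called black if no simple module on it has projective dimension $1$. For a set $X$ of vertices let $\xi_X\in\{0,1\}^n$ be its indicator vector, and for a cycle $C$ write $\xi_C$ for the indicator vector of its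 set of vertices. Let $\mathbf 1=(1,\dots,1)^T$, let $\Gamma$ be the set of cycles and let $B\Gamma\subseteq\Gamma$ be the set of black cycles of the resolution quiver. Then $\Gamma$ is nonempty, all cycles in $\Gamma$ have the same weight, and this common weight $w(A)$ is a nonnegative integer. Moreover: 1. Over every field of characteristic $0$, the vectors $\{\xi_C\}_{C\in\Gamma}$ are solutions of the linear system $\mathbf C_A\,\xi=w(A)\mathbf 1$, they are linearly independent, and they form a maximal linearly independent set of solutions. 2. The vectors $\{\xi_C\}_{C\in\Gamma}$ are exactly the solutions of $\mathbf C_A\,\xi=w(A)\mathbf 1$ with nonnegative integer entries. 3. Over every field of characteristic $0$, the vectors $\{\xi_E\}_{E\in B\Gamma}$ are solutions of the linear system $\mathbf C_A^T\,\xi=\mathbf C_A\,\xi=w(A)\mathbf 1$, they are linearly independent, and they form a maximal linearly independent set of solutions. (If $B\Gamma=\varnothing$, this says that the system has no solution.) -/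

import Mathlib

open Matrix

universe u v w

namespace NakayamaAlgebra

noncomputable section

/-! ### Modules: indecomposable, uniserial, socle, projective covers, injective envelopes -/

/-- A module is indecomposable if it is nonzero and is not the direct sum of two nonzero
submodules. -/
def IsIndecomposable (R : Type u) [Ring R] (M : Type v) [AddCommGroup M] [Module R M] : Prop :=
  Nontrivial M ∧ ∀ N N' : Submodule R M, IsCompl N N' → N = ⊥ ∨ N' = ⊥

/-- A module is uniserial if its submodules are totally ordered by inclusion. -/
def IsUniserial (R : Type u) [Ring R] (M : Type v) [AddCommGroup M] [Module R M] : Prop :=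
  ∀ N N' : Submodule R M, N ≤ N' ∨ N' ≤ N

/-- The socle of a module: the sum of its simple submodules. -/
def socle (R : Type u) [Ring R] (M : Type v) [AddCommGroup M] [Module R M] : Submodule R M :=
  sSup {N : Submodule R M | IsSimpleModule R N}

/-- `f : P → M` is a projective cover: `P` is projective, and `f` is surjective with superfluous
kernel. -/
structure IsProjectiveCover {R : Type u} [Ring R] {P M : Type v} [AddCommGroup P] [Module R P]
    [AddCommGroup M] [Module R M] (f : P →ₗ[R] M) : Prop where
  projective : Module.Projective R P
  surjective : Function.Surjective f
  superfluous : ∀ N : Submodule R P, N ⊔ LinearMap.ker f = ⊤ → N = ⊤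

/-- `f : M → E` is an injective envelope: `E` is injective, and `f` is injective with essential
image. -/
structure IsInjectiveEnvelope {R : Type u} [Ring R] {M E : Type u} [AddCommGroup M] [Module R M]
    [AddCommGroup E] [Module R E] (f : M →ₗ[R] E) : Prop where
  injective_module : Module.Injective R E
  injective : Function.Injective f
  essential : ∀ N : Submodule R E, N ⊓ LinearMap.range f = ⊥ → N = ⊥

/-! ### Connected Nakayama algebras -/

/-- A ring is connected if it is nonzero and its only central idempotents are `0` and `1`. -/
structure IsConnected (A : Type u) [Ring A] : Prop where
  nontrivial : Nontrivial A
  central_idempotent : ∀ e : A, e * e = e → (∀ a : A, a * e = e * a) → e = 0 ∨ e = 1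

/-- Every indecomposable finitely generated projective left `R`-module is uniserial. -/
def IsSerialRing (R : Type u) [Ring R] : Prop :=
  ∀ (P : Type u) [AddCommGroup P] [Module R P] [Module.Finite R P] [Module.Projective R P],
    IsIndecomposable R P → IsUniserial R P

/-- A Nakayama ring: all indecomposable projective left modules and all indecomposable projective
right modules (that is, left modules over the opposite ring) are uniserial. -/
structure IsNakayama (A : Type u) [Ring A] : Prop where
  left : IsSerialRing A
  right : IsSerialRing Aᵐᵒᵖ

/-! ### The Auslander-Reiten translation `D Tr` of an Artin algebra -/

/-- A minimal projective presentation `P₁ → P₀ → M → 0`: `p` is a projective cover of `M`, and `d`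
corestricts to a projective cover of `ker p`. -/
structure IsMinimalPresentation {A : Type u} [Ring A] {P₁ P₀ M : Type u}
    [AddCommGroup P₁] [Module A P₁] [AddCommGroup P₀] [Module A P₀] [AddCommGroup M] [Module A M]
    (d : P₁ →ₗ[A] P₀) (p : P₀ →ₗ[A] M) : Prop where
  cover : IsProjectiveCover p
  mem_ker : ∀ x, d x ∈ LinearMap.ker p
  cover_ker : IsProjectiveCover (d.codRestrict (LinearMap.ker p) mem_ker)

/-- The cokernel of `Hom_A(d, A) : Hom_A(P₀, A) → Hom_A(P₁, A)`, a right `A`-module. If `d` is part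
of a minimal projective presentation of `M`, this is the transpose `Tr M`. -/
abbrev Transpose {A : Type u} [Ring A] {P₁ P₀ : Type u} [AddCommGroup P₁] [Module A P₁]
    [AddCommGroup P₀] [Module A P₀] (d : P₁ →ₗ[A] P₀) : Type u :=
  (P₁ →ₗ[A] A) ⧸ LinearMap.range (LinearMap.lcomp Aᵐᵒᵖ A d)

/-- `Hom_k(X, E)` for a right `A`-module `X`. For `E` an injective envelope of `k / rad k`, this is
the usual dual `D X`. -/
def RightDual (k : Type w) (A X : Type u) (E : Type w) [CommRing k] [Ring A] [Algebra k A]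
    [AddCommGroup X] [Module k X] [Module Aᵐᵒᵖ X] [IsScalarTower k Aᵐᵒᵖ X] [AddCommGroup E]
    [Module k E] : Type (max u w) :=
  X →ₗ[k] E

section RightDual

variable (k : Type w) (A X : Type u) (E : Type w) [CommRing k] [Ring A] [Algebra k A]
  [AddCommGroup X] [Module k X] [Module Aᵐᵒᵖ X] [IsScalarTower k Aᵐᵒᵖ X] [AddCommGroup E]
  [Module k E]

instance : AddCommGroup (RightDual k A X E) :=
  inferInstanceAs (AddCommGroup (X →ₗ[k] E))

/-- The left `A`-module structure on `Hom_k(X, E)`, given by `(a f)(x) = f(x a)`. -/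
instance : Module A (RightDual k A X E) where
  smul a f := LinearMap.comp (show X →ₗ[k] E from f) (Module.toModuleEnd k X (MulOpposite.op a))
  one_smul f := by
    apply LinearMap.ext; intro x
    change (show X →ₗ[k] E from f) (MulOpposite.op (1 : A) • x) = _
    rw [MulOpposite.op_one, one_smul]
  mul_smul a b f := by
    apply LinearMap.ext; intro x
    change (show X →ₗ[k] E from f) (MulOpposite.op (a * b) • x)
      = (show X →ₗ[k] E from f) (MulOpposite.op b • MulOpposite.op a • x)
    rw [MulOpposite.op_mul, mul_smul]
  smul_zero a := by
    apply LinearMap.ext; intro x; rfl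
  smul_add a f g := by
    apply LinearMap.ext; intro x; rfl
  add_smul a b f := by
    apply LinearMap.ext; intro x
    change (show X →ₗ[k] E from f) (MulOpposite.op (a + b) • x)
      = (show X →ₗ[k] E from f) (MulOpposite.op a • x)
        + (show X →ₗ[k] E from f) (MulOpposite.op b • x)
    rw [MulOpposite.op_add, add_smul, map_add]
  zero_smul f := by
    apply LinearMap.ext; intro x
    change (show X →ₗ[k] E from f) (MulOpposite.op (0 : A) • x) = (0 : E)
    rw [MulOpposite.op_zero, zero_smul, map_zero]

theorem rightDual_smul_apply (a : A) (f : RightDual k A X E) (x : X) :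
    (show X →ₗ[k] E from a • f) x = (show X →ₗ[k] E from f) (MulOpposite.op a • x) := rfl

end RightDual

/-- `T` is isomorphic to the Auslander-Reiten translate `τ(M) = D Tr M`. -/
def IsARTranslate (k : Type w) (A : Type u) [CommRing k] [Ring A] [Algebra k A]
    (M T : Type u) [AddCommGroup M] [Module A M] [AddCommGroup T] [Module A T] : Prop :=
  ∃ (P₁ P₀ : Type u) (_ : AddCommGroup P₁) (_ : Module A P₁) (_ : AddCommGroup P₀)
    (_ : Module A P₀) (d : P₁ →ₗ[A] P₀) (p : P₀ →ₗ[A] M) (E : Type w) (_ : AddCommGroup E)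
    (_ : Module k E) (i : (k ⧸ Ring.jacobson k) →ₗ[k] E),
    IsMinimalPresentation d p ∧ IsInjectiveEnvelope i ∧
      Nonempty (T ≃ₗ[A] RightDual k A (Transpose d) E)

/-- For simple modules `M` and `T`: `T ≅ τ̃(M)`, where `τ̃(M)` is `τ(M)` if `M` is not projective, and
the simple injective module if `M` is projective. -/
def IsTauTilde (k : Type w) (A : Type u) [CommRing k] [Ring A] [Algebra k A]
    (M T : Type u) [AddCommGroup M] [Module A M] [AddCommGroup T] [Module A T] : Prop :=
  (¬ Module.Projective A M ∧ IsARTranslate k A M T) ∨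
    (Module.Projective A M ∧ Module.Injective A T)

/-! ### Simple modules, composition multiplicities and the Cartan matrix -/

/-- `S` is a complete family of pairwise non-isomorphic simple `A`-modules. -/
structure IsCompleteFamilyOfSimples (A : Type u) [Ring A] {n : ℕ} (S : Fin n → Type u)
    [∀ i, AddCommGroup (S i)] [∀ i, Module A (S i)] : Prop where
  simple : ∀ i, IsSimpleModule A (S i)
  pairwise : ∀ i j, Nonempty (S i ≃ₗ[A] S j) → i = j
  complete : ∀ (T : Type u) [AddCommGroup T] [Module A T], IsSimpleModule A T →
    ∃ i, Nonempty (T ≃ₗ[A] S i)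

/-- The number of factors of the composition series `s` that are isomorphic to `S`. -/
def factorCount {A : Type u} [Ring A] (S : Type u) [AddCommGroup S] [Module A S] {M : Type u}
    [AddCommGroup M] [Module A M] (s : CompositionSeries (Submodule A M)) : ℕ :=
  Nat.card {i : Fin s.length //
    Nonempty ((s i.succ ⧸ (s i.castSucc).comap (s i.succ).subtype) ≃ₗ[A] S)}

open Classical in
/-- The number of copies of `S` in a composition series of `M` (from `0` to `M`). It does not depend
on the series, see `multiplicity_eq_factorCount`; it is `0` if there is no composition series. -/
def multiplicity (A : Type u) [Ring A] (S : Type u) [AddCommGroup S] [Module A S] (M : Type u)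
    [AddCommGroup M] [Module A M] : ℕ :=
  if h : ∃ s : CompositionSeries (Submodule A M), s.head = ⊥ ∧ s.last = ⊤ then
    factorCount S h.choose
  else 0

theorem multiplicity_eq_factorCount {A : Type u} [Ring A] (S : Type u) [AddCommGroup S]
    [Module A S] {M : Type u} [AddCommGroup M] [Module A M]
    (s : CompositionSeries (Submodule A M)) (h₀ : s.head = ⊥) (h₁ : s.last = ⊤) :
    multiplicity A S M = factorCount S s := by
  have h : ∃ s : CompositionSeries (Submodule A M), s.head = ⊥ ∧ s.last = ⊤ := ⟨s, h₀, h₁⟩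
  rw [multiplicity, dif_pos h]
  obtain ⟨h₀', h₁'⟩ := h.choose_spec
  obtain ⟨e, he⟩ := CompositionSeries.jordan_holder h.choose s (h₀'.trans h₀.symm)
    (h₁'.trans h₁.symm)
  refine Nat.card_congr (e.subtypeEquiv fun i => ?_)
  have f := (he i).linearEquiv
  exact ⟨fun ⟨g⟩ => ⟨f.symm.trans g⟩, fun ⟨g⟩ => ⟨f.trans g⟩⟩

variable (k : Type w) (A : Type u) [CommRing k] [Ring A] [Algebra k A] {n : ℕ} (S P : Fin n → Type u)
  [∀ i, AddCommGroup (S i)] [∀ i, Module A (S i)] [∀ i, AddCommGroup (P i)] [∀ i, Module A (P i)]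

/-- The Cartan matrix: its `(i, j)` entry is the multiplicity of `S i` in the projective cover `P j`
of `S j`. -/
def cartanMatrix : Matrix (Fin n) (Fin n) ℕ :=
  Matrix.of fun i j => multiplicity A (S i) (P j)

/-! ### The resolution quiver -/

/-- The arrows of the resolution quiver: there is an arrow from `i` to `j` if and only if
`S j ≅ τ̃(soc (P i))`, where `P i` is the projective cover of `S i`. -/
def Arrow (i j : Fin n) : Prop :=
  IsTauTilde k A (socle A (P i)) (S j)

/-- The set of (oriented, nonempty, non-repeating) cycles of the resolution quiver. -/
def cycles : Set (Cycle (Fin n)) :=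
  {c | c ≠ Cycle.nil ∧ c.Nodup ∧ c.Chain (Arrow k A S P)}

/-- The black cycles: no simple module on the cycle has projective dimension `1`. -/
def blackCycles : Set (Cycle (Fin n)) :=
  {c | c ∈ cycles k A S P ∧
    ∀ i ∈ c, CategoryTheory.projectiveDimension (ModuleCat.of A (S i)) ≠ 1}

/-- The weight of a cycle: the sum of the composition lengths of the `P i`, for `i` on the cycle,
divided by the number `n` of simple modules. -/
def weight (c : Cycle (Fin n)) : ℚ :=
  ∑ i ∈ c.toFinset, ((Module.length A (P i)).toNat : ℚ) / n

/-- The indicator vector of a set of vertices. -/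
def indicatorVector (R : Type v) [Zero R] [One R] (X : Finset (Fin n)) : Fin n → R :=
  fun i => if i ∈ X then 1 else 0

/-! ### Maximal linearly independent families -/

/-- The family `x` consists of elements of the set `Z`, is linearly independent, and is maximal:
no linearly independent subset of `Z` properly contains the set of its members. -/
structure IsMaximalIndependentIn (K : Type v) [Field K] {V ι : Type*} [AddCommGroup V] [Module K V]
    (x : ι → V) (Z : Set V) : Prop where
  mem : ∀ i, x i ∈ Z
  linearIndependent : LinearIndependent K x
  maximal : ∀ Y : Set V, Set.range x ⊆ Y → Y ⊆ Z → LinearIndepOn K id Y → Y = Set.range x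

end

end NakayamaAlgebra

open NakayamaAlgebra

/-! Everything reduces to a permutation `σ` of the vertices and the lengths `c i` of the `P i`. Left
uniseriality makes rad `P i`, when nonzero, a quotient of a single `P (σ i)`. Right uniseriality
makes this partial successor map injective, and connectedness makes any extension of it to a
permutation one `n`-cycle (`exists_perm_isSuccessor`, `sameCycle_of_isConnected`). From the top
down, the composition factors of `P j` are `S j, S (σ j), ..., S (σ ^ (c j - 1) j)`. This determines
the Cartan matrix and the socle. Since τ̃ acts on simples as `σ`, the resolution quiver is the graph
of `f i = σ ^ c i i` (`arrow_iff`).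

Let `C` be the Cartan matrix. Consecutive entries of `C ξ` differ by `ξ (σ i)` minus the sum of `ξ`
over the fibre of `f` at `σ i`, by telescoping. So `C ξ` is constant only if `ξ` equals its
push-forward along `f`. Such a `ξ` vanishes off the cycles of `f` and is constant on each, so
indicators of cycles span. Column `j` of `C` sums to `c j`, so the constant attached to a cycle is
its weight.

All weights agree because `c i ≤ c (σ i) + 1` says that `f` lifts to a monotone map of the integers
commuting with translation by `n`. The weight divided by the period is its rotation number, and all
periods coincide (`iterate_kupischMap_eq_self_of_sum_eq`).

For natural solutions, subtracting the indicator of one cycle in the support leaves a nonnegative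
vector killed by `C`, which is zero because the diagonal of `C` is positive.

For the transpose, projective dimension 1 of `S i` means `c i = c (σ i) + 1`. Then rows `i` and `σ
i` of the transposed system force `ξ i = 0`, which excludes non-black cycles. On a black cycle,
monotonicity of the lift gives the converse. -/

namespace NakayamaAlgebra

noncomputable section

/-! ### Cycles of the graph of a self-map -/

section FunctionalCycles

variable {α : Type*} (f : α → α)

/-- The oriented cycles of the graph of a self-map. -/
def functionalCycles : Set (Cycle α) :=
  {c | c ≠ Cycle.nil ∧ c.Nodup ∧ c.Chain fun a b => f a = b}

variable {f}

/-- Rotate the cycle so that `a` is its head. The entries are then the iterates of `a`, closing up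
gives a period, and the absence of repetitions makes this period minimal. -/
theorem eq_periodicOrbit_of_mem {c : Cycle α} (hc : c ∈ functionalCycles f) {a : α} (ha : a ∈ c) :
    a ∈ Function.periodicPts f ∧ c = Function.periodicOrbit f a := by
  obtain ⟨-, hnd, hch⟩ := hc
  induction c using Quotient.inductionOn' with | h l =>
  change a ∈ l at ha
  obtain ⟨s, t, rfl⟩ := List.mem_iff_append.1 ha
  have hrot : (Quotient.mk'' (s ++ a :: t) : Cycle α) = ((a :: (t ++ s) : List α) : Cycle α) :=
    Quotient.sound' (show s ++ a :: t ~r a :: (t ++ s) from List.isRotated_append)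
  rw [hrot] at hnd hch ⊢
  set L := t ++ s with hL
  rw [Cycle.chain_coe_cons, List.isChain_iff_getElem] at hch
  have key : ∀ i (hi : i < (a :: (L ++ [a])).length), (a :: (L ++ [a]))[i] = f^[i] a := by
    intro i
    induction i with
    | zero => intro _; rfl
    | succ i ih =>
      intro hi
      rw [← hch i hi, ih (by omega), Function.iterate_succ_apply']
  have key' : ∀ i (hi : i < (a :: L).length), (a :: L)[i] = f^[i] a := by
    intro i hi
    rw [← key i (by simp at hi ⊢; omega)]
    have : a :: (L ++ [a]) = (a :: L) ++ [a] := rfl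
    simp only [this]
    rw [List.getElem_append_left hi]
  have hper : f^[L.length + 1] a = a := by
    rw [← key (L.length + 1) (by simp)]
    simp
  have hnd' : (a :: L).Nodup := hnd
  have hmp : Function.minimalPeriod f a = L.length + 1 := by
    have hpos : 0 < Function.minimalPeriod f a :=
      Function.IsPeriodicPt.minimalPeriod_pos (Nat.succ_pos L.length) hper
    have hle : Function.minimalPeriod f a ≤ L.length + 1 :=
      Function.IsPeriodicPt.minimalPeriod_le (Nat.succ_pos L.length) hper
    refine le_antisymm hle (not_lt.1 fun hlt => ?_)
    have h1 := key' (Function.minimalPeriod f a) (by simpa using hlt)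
    rw [(Function.isPeriodicPt_minimalPeriod f a : _ = a)] at h1
    have h2 := (List.Nodup.getElem_inj_iff hnd' (hi := by simpa using hlt)
      (j := 0) (hj := by simp)).1 (by rw [h1]; rfl)
    omega
  refine ⟨⟨L.length + 1, Nat.succ_pos _, hper⟩, ?_⟩
  rw [Function.periodicOrbit_def, hmp]
  congr 1
  refine List.ext_getElem (by simp) fun i h1 h2 => ?_
  rw [key' i h1, List.getElem_map, List.getElem_range]

theorem periodicOrbit_mem_functionalCycles {a : α} (ha : a ∈ Function.periodicPts f) :
    Function.periodicOrbit f a ∈ functionalCycles f := by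
  refine ⟨fun h => ?_, Function.nodup_periodicOrbit, ?_⟩
  · exact Function.periodicOrbit_eq_nil_iff_not_periodic_pt.1 h ha
  · rw [Function.periodicOrbit_chain' _ ha]
    intro n
    rw [Function.iterate_succ_apply']

theorem exists_mem_of_mem_functionalCycles {c : Cycle α} (hc : c ∈ functionalCycles f) :
    ∃ a, a ∈ c := by
  obtain ⟨hne, -, -⟩ := hc
  induction c using Quotient.inductionOn' with | h l =>
  cases l with
  | nil => exact absurd rfl hne
  | cons a l => exact ⟨a, List.mem_cons_self⟩

theorem eq_of_mem_of_mem {c c' : Cycle α} (hc : c ∈ functionalCycles f)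
    (hc' : c' ∈ functionalCycles f) {a : α} (ha : a ∈ c) (ha' : a ∈ c') : c = c' := by
  rw [(eq_periodicOrbit_of_mem hc ha).2, (eq_periodicOrbit_of_mem hc' ha').2]

theorem map_mem_iff_of_mem_periodicPts {c : Cycle α} (hc : c ∈ functionalCycles f) {a : α}
    (ha : a ∈ Function.periodicPts f) : f a ∈ c ↔ a ∈ c := by
  constructor
  · intro h
    rw [(eq_periodicOrbit_of_mem hc h).2, Function.periodicOrbit_apply_eq ha]
    exact Function.self_mem_periodicOrbit ha
  · intro h
    rw [(eq_periodicOrbit_of_mem hc h).2]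
    exact Function.iterate_mem_periodicOrbit ha 1

theorem map_mem_of_mem {c : Cycle α} (hc : c ∈ functionalCycles f) {a : α} (ha : a ∈ c) :
    f a ∈ c :=
  (map_mem_iff_of_mem_periodicPts hc (eq_periodicOrbit_of_mem hc ha).1).2 ha

theorem exists_mem_map_eq {c : Cycle α} (hc : c ∈ functionalCycles f) {a : α} (ha : a ∈ c) :
    ∃ b ∈ c, f b = a := by
  have hp := (eq_periodicOrbit_of_mem hc ha).1
  obtain ⟨b, hb, rfl⟩ := (Function.bijOn_periodicPts f).surjOn hp
  exact ⟨b, (map_mem_iff_of_mem_periodicPts hc hb).1 ha, rfl⟩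

theorem mem_cycle_toFinset [DecidableEq α] {c : Cycle α} {a : α} : a ∈ c.toFinset ↔ a ∈ c := by
  induction c using Quotient.inductionOn' with | h l =>
  exact List.mem_toFinset

theorem functionalCycles_nonempty [Finite α] [Nonempty α] : (functionalCycles f).Nonempty := by
  obtain ⟨a⟩ := ‹Nonempty α›
  obtain ⟨i, j, hij, h⟩ := Finite.exists_ne_map_eq_of_infinite fun n : ℕ => f^[n] a
  wlog hlt : i < j generalizing i j
  · exact this j i hij.symm h.symm (by omega)
  refine ⟨_, periodicOrbit_mem_functionalCycles (a := f^[i] a) ⟨j - i, by omega, ?_⟩⟩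
  change f^[j - i] (f^[i] a) = f^[i] a
  rw [← Function.iterate_add_apply, Nat.sub_add_cancel hlt.le]
  exact h.symm

theorem sum_toFinset_periodicOrbit [DecidableEq α] {M : Type*} [AddCommMonoid M] (g : α → M) {a : α} :
    ∑ i ∈ (Function.periodicOrbit f a).toFinset, g i =
      ∑ i ∈ Finset.range (Function.minimalPeriod f a), g (f^[i] a) := by
  have h : (Function.periodicOrbit f a).toFinset =
      (Finset.range (Function.minimalPeriod f a)).image fun i => f^[i] a := by
    ext x
    rw [mem_cycle_toFinset, Function.periodicOrbit_def, Cycle.mem_coe_iff]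
    simp [eq_comm]
  rw [h, Finset.sum_image]
  intro i hi j hj hij
  simp only [Finset.coe_range, Set.mem_Iio] at hi hj
  exact le_antisymm (Function.le_of_lt_minimalPeriod_of_iterate_eq hi hij)
    (Function.le_of_lt_minimalPeriod_of_iterate_eq hj hij.symm)

end FunctionalCycles

/-! ### Vectors that are invariant under push-forward -/

section Pushforward

variable {n : ℕ} {f : Fin n → Fin n}

/-- Every vertex of the support has a preimage in the support. A choice of preimages is an injective
self-map of a finite set, so its points are periodic, and `f` runs these orbits backwards.
Cancellation among coefficients plays no role. -/
theorem mem_periodicPts_of_pushforward {R : Type*} [AddCommMonoid R] {ξ : Fin n → R}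
    (h : ∀ i, ξ i = ∑ j with f j = i, ξ j) {i : Fin n} (hi : ξ i ≠ 0) :
    i ∈ Function.periodicPts f := by
  have hex : ∀ x : {i // ξ i ≠ 0}, ∃ y : {i // ξ i ≠ 0}, f y = x := by
    rintro ⟨x, hx⟩
    rw [h x] at hx
    obtain ⟨j, hj, hne⟩ := Finset.exists_ne_zero_of_sum_ne_zero hx
    exact ⟨⟨j, hne⟩, (Finset.mem_filter.1 hj).2⟩
  choose g hg using hex
  have hinj : Function.Injective g := fun x y hxy => Subtype.ext (by rw [← hg x, ← hg y, hxy])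
  obtain ⟨m, hm, hp⟩ := hinj.mem_periodicPts ⟨i, hi⟩
  have hit : ∀ (k : ℕ) (x : {i // ξ i ≠ 0}), f^[k] (g^[k] x : {i // ξ i ≠ 0}) = x := by
    intro k
    induction k with
    | zero => intro x; rfl
    | succ k ih =>
      intro x
      rw [Function.iterate_succ_apply, Function.iterate_succ_apply', hg, ih]
  refine ⟨m, hm, ?_⟩
  have := hit m ⟨i, hi⟩
  rwa [hp] at this

/-- `f` is injective on periodic points, so `i` is the only preimage of `f i` that can carry a
nonzero coefficient. -/
theorem map_eq_of_pushforward {R : Type*} [AddCommMonoid R] {ξ : Fin n → R}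
    (h : ∀ i, ξ i = ∑ j with f j = i, ξ j) {i : Fin n} (hi : i ∈ Function.periodicPts f) :
    ξ (f i) = ξ i := by
  rw [h (f i)]
  refine Finset.sum_eq_single_of_mem i (by simp) fun j hj hne => ?_
  by_contra h0
  exact hne ((Function.bijOn_periodicPts f).injOn (mem_periodicPts_of_pushforward h h0) hi
    (Finset.mem_filter.1 hj).2)

theorem eq_of_pushforward {R : Type*} [AddCommMonoid R] {ξ : Fin n → R}
    (h : ∀ i, ξ i = ∑ j with f j = i, ξ j) {c : Cycle (Fin n)} (hc : c ∈ functionalCycles f)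
    {i j : Fin n} (hi : i ∈ c) (hj : j ∈ c) : ξ i = ξ j := by
  obtain ⟨hp, he⟩ := eq_periodicOrbit_of_mem hc hi
  rw [he, Function.mem_periodicOrbit_iff hp] at hj
  obtain ⟨m, rfl⟩ := hj
  induction m with
  | zero => rfl
  | succ m ih =>
    rw [Function.iterate_succ_apply', map_eq_of_pushforward h, ih]
    exact (Function.bijOn_periodicPts f).mapsTo.iterate m hp

theorem indicatorVector_pushforward {R : Type*} [Semiring R] {c : Cycle (Fin n)}
    (hc : c ∈ functionalCycles f) (i : Fin n) :
    indicatorVector R c.toFinset i = ∑ j with f j = i, indicatorVector R c.toFinset j := by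
  by_cases hi : i ∈ c
  · obtain ⟨b, hb, rfl⟩ := exists_mem_map_eq hc hi
    rw [Finset.sum_eq_single_of_mem b (by simp)]
    · simp [indicatorVector, mem_cycle_toFinset, hi, hb]
    · intro j hj hne
      have : j ∉ c := fun hjc => hne ((Function.bijOn_periodicPts f).injOn
        (eq_periodicOrbit_of_mem hc hjc).1 (eq_periodicOrbit_of_mem hc hb).1
        (Finset.mem_filter.1 hj).2)
      simp [indicatorVector, mem_cycle_toFinset, this]
  · rw [Finset.sum_eq_zero]
    · simp [indicatorVector, mem_cycle_toFinset, hi]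
    · intro j hj
      have : j ∉ c := fun hjc => hi ((Finset.mem_filter.1 hj).2 ▸ map_mem_of_mem hc hjc)
      simp [indicatorVector, mem_cycle_toFinset, this]

variable {K : Type v} [Field K]

theorem finite_functionalCycles : (functionalCycles f).Finite := by
  refine Set.Finite.of_finite_image (f := fun c : Cycle (Fin n) => c.toFinset) (Set.toFinite _) ?_
  intro c hc c' hc' h
  obtain ⟨a, ha⟩ := exists_mem_of_mem_functionalCycles hc
  have h' : a ∈ c'.toFinset := (show c.toFinset = c'.toFinset from h) ▸ mem_cycle_toFinset.2 ha
  exact eq_of_mem_of_mem hc hc' ha (mem_cycle_toFinset.1 h')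

theorem linearIndependent_indicatorVector {T : Set (Cycle (Fin n))} (hT : T ⊆ functionalCycles f) :
    LinearIndependent K fun c : T => indicatorVector K (c : Cycle (Fin n)).toFinset := by
  rw [linearIndependent_iff']
  intro s g hg c hc
  obtain ⟨a, ha⟩ := exists_mem_of_mem_functionalCycles (hT c.2)
  have h := congrFun hg a
  rw [Finset.sum_apply, Finset.sum_eq_single_of_mem c hc] at h
  · simpa [indicatorVector, mem_cycle_toFinset, ha] using h
  · intro d _ hd
    have : a ∉ (d : Cycle (Fin n)) := fun had =>
      hd (Subtype.ext (eq_of_mem_of_mem (hT d.2) (hT c.2) had ha))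
    simp [indicatorVector, mem_cycle_toFinset, this]

/-- The subset `T` allows one statement to serve both all cycles and black cycles. -/
theorem mem_span_indicatorVector {T : Set (Cycle (Fin n))} (hT : T ⊆ functionalCycles f)
    {ξ : Fin n → K} (h : ∀ i, ξ i = ∑ j with f j = i, ξ j)
    (h0 : ∀ c ∈ functionalCycles f, c ∉ T → ∀ i ∈ c, ξ i = 0) :
    ξ ∈ Submodule.span K
      (Set.range fun c : T => indicatorVector K (c : Cycle (Fin n)).toFinset) := by
  have : Fintype T := (finite_functionalCycles.subset hT).fintype
  choose a ha using fun c : T => exists_mem_of_mem_functionalCycles (hT c.2)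
  have heq : ξ = ∑ c : T, ξ (a c) • indicatorVector K (c : Cycle (Fin n)).toFinset := by
    funext i
    rw [Finset.sum_apply]
    by_cases hi : ∃ c : T, i ∈ (c : Cycle (Fin n))
    · obtain ⟨c, hc⟩ := hi
      rw [Finset.sum_eq_single_of_mem c (Finset.mem_univ _)]
      · simp [indicatorVector, mem_cycle_toFinset, hc, eq_of_pushforward h (hT c.2) hc (ha c)]
      · intro d _ hd
        have : i ∉ (d : Cycle (Fin n)) := fun had =>
          hd (Subtype.ext (eq_of_mem_of_mem (hT d.2) (hT c.2) had hc))
        simp [indicatorVector, mem_cycle_toFinset, this]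
    · push Not at hi
      rw [Finset.sum_eq_zero]
      · by_contra hne
        have hp := mem_periodicPts_of_pushforward h hne
        by_cases hmem : Function.periodicOrbit f i ∈ T
        · exact hi ⟨_, hmem⟩ (Function.self_mem_periodicOrbit hp)
        · exact hne (h0 _ (periodicOrbit_mem_functionalCycles hp) hmem i
            (Function.self_mem_periodicOrbit hp))
      · intro c _
        simp [indicatorVector, mem_cycle_toFinset, hi c]
  rw [heq]
  exact Submodule.sum_mem _ fun c _ => Submodule.smul_mem _ _ (Submodule.subset_span ⟨c, rfl⟩)

theorem isMaximalIndependentIn_of_subset_span {V ι : Type*} [AddCommGroup V] [Module K V]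
    {x : ι → V} {Z : Set V} (hmem : ∀ i, x i ∈ Z) (hli : LinearIndependent K x)
    (hspan : ∀ z ∈ Z, z ∈ Submodule.span K (Set.range x)) : IsMaximalIndependentIn K x Z := by
  refine ⟨hmem, hli, fun Y hxY hYZ hY => (hxY.antisymm fun y hy => ?_).symm⟩
  by_contra hyx
  have h1 : LinearIndepOn K id (insert y (Set.range x)) :=
    hY.mono (Set.insert_subset hy hxY)
  have h2 := h1.notMem_span_of_insert hyx
  rw [Set.image_id] at h2
  exact h2 (hspan y (hYZ hy))

end Pushforward

/-! ### The combinatorics of Kupisch series -/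

section Kupisch

variable {n : ℕ} (σ : Equiv.Perm (Fin n)) (c : Fin n → ℕ)

/-- The map whose graph is the resolution quiver of a Nakayama algebra with cyclic order `σ` and
Kupisch series `c`. -/
def kupischMap (i : Fin n) : Fin n := (σ ^ c i) i

/-- The Cartan matrix of a Nakayama algebra with cyclic order `σ` and Kupisch series `c`. -/
def kupischMatrix : Matrix (Fin n) (Fin n) ℕ :=
  Matrix.of fun i j => ((Finset.range (c j)).filter fun t => (σ ^ t) j = i).card

variable {σ c}

theorem kupischMatrix_eq_sum {R : Type*} [Semiring R] (i j : Fin n) :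
    ((kupischMatrix σ c i j : ℕ) : R) =
      ∑ t ∈ Finset.range (c j), if (σ ^ t) j = i then 1 else 0 := by
  simp [kupischMatrix]

theorem kupischMatrix_transpose_mulVec {R : Type*} [Semiring R] (ξ : Fin n → R) (j : Fin n) :
    ((kupischMatrix σ c)ᵀ.map (Nat.cast : ℕ → R) *ᵥ ξ) j =
      ∑ t ∈ Finset.range (c j), ξ ((σ ^ t) j) := by
  simp only [Matrix.mulVec, dotProduct, Matrix.map_apply, Matrix.transpose_apply,
    kupischMatrix_eq_sum, Finset.sum_mul]
  rw [Finset.sum_comm]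
  simp

/-- Column `j` counts visits of the path `j, σ j, ...` of length `c j`. Passing from row `i` to row
`σ i` shifts the path by one step, so only its two ends contribute: the start `j` and the point
`kupischMap σ c j` just past the end. -/
theorem kupischMatrix_mulVec_sub {R : Type*} [CommRing R] (ξ : Fin n → R) (i : Fin n) :
    ((kupischMatrix σ c).map (Nat.cast : ℕ → R) *ᵥ ξ) (σ i) -
      ((kupischMatrix σ c).map (Nat.cast : ℕ → R) *ᵥ ξ) i =
      ξ (σ i) - ∑ j with kupischMap σ c j = σ i, ξ j := by
  simp only [Matrix.mulVec, dotProduct, Matrix.map_apply, kupischMatrix_eq_sum]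
  rw [← Finset.sum_sub_distrib]
  have h : ∀ j : Fin n,
      (∑ t ∈ Finset.range (c j), if (σ ^ t) j = σ i then (1 : R) else 0) * ξ j -
        (∑ t ∈ Finset.range (c j), if (σ ^ t) j = i then (1 : R) else 0) * ξ j =
      (if j = σ i then ξ j else 0) - (if kupischMap σ c j = σ i then ξ j else 0) := by
    intro j
    have h1 : ∀ t, (if (σ ^ t) j = i then (1 : R) else 0) =
        if (σ ^ (t + 1)) j = σ i then (1 : R) else 0 := by
      intro t
      simp [pow_succ', Equiv.Perm.mul_apply]
    simp only [h1]
    rw [← sub_mul, ← Finset.sum_sub_distrib,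
      Finset.sum_range_sub' fun t => if (σ ^ t) j = σ i then (1 : R) else 0, sub_mul]
    simp only [pow_zero, Equiv.Perm.coe_one, id, ite_mul, one_mul, zero_mul]
    rfl
  rw [Finset.sum_congr rfl fun j _ => h j, Finset.sum_sub_distrib]
  simp [Finset.sum_filter]

theorem one_le_kupischMatrix_self (hc : ∀ i, 1 ≤ c i) (i : Fin n) : 1 ≤ kupischMatrix σ c i i := by
  rw [kupischMatrix, Matrix.of_apply, Nat.succ_le_iff, Finset.card_pos]
  exact ⟨0, Finset.mem_filter.2 ⟨Finset.mem_range.2 (hc i), rfl⟩⟩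

theorem eq_of_forall_apply_eq {β : Type*} (hσ : ∀ x y, σ.SameCycle x y) {g : Fin n → β}
    (hg : ∀ i, g (σ i) = g i) (i j : Fin n) : g i = g j := by
  obtain ⟨m, rfl⟩ := hσ i j
  have hz : ∀ (m : ℕ) x, g ((σ ^ m) x) = g x := by
    intro m
    induction m with
    | zero => intro x; rfl
    | succ m ih => intro x; rw [pow_succ', Equiv.Perm.mul_apply, hg, ih]
  rcases m with m | m
  · rw [Int.ofNat_eq_natCast, zpow_natCast, hz]
  · rw [zpow_negSucc, ← hz (m + 1) ((σ ^ (m + 1))⁻¹ i)]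
    simp

variable (hσ : ∀ x y, σ.SameCycle x y)
include hσ

omit hσ in
theorem pushforward_of_mulVec_eq_const {R : Type*} [CommRing R] {ξ : Fin n → R} {w : R}
    (h : (kupischMatrix σ c).map (Nat.cast : ℕ → R) *ᵥ ξ = fun _ => w) (i : Fin n) :
    ξ i = ∑ j with kupischMap σ c j = i, ξ j := by
  have := kupischMatrix_mulVec_sub (σ := σ) (c := c) ξ (σ.symm i)
  rw [h, sub_self, Equiv.apply_symm_apply] at this
  exact (sub_eq_zero.1 this.symm)

theorem exists_mulVec_indicatorVector_eq_const [Nonempty (Fin n)] {C : Cycle (Fin n)}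
    (hC : C ∈ functionalCycles (kupischMap σ c)) :
    ∃ w : ℕ, (kupischMatrix σ c *ᵥ indicatorVector ℕ C.toFinset = fun _ => w) ∧
      n * w = ∑ i ∈ C.toFinset, c i := by
  obtain ⟨a⟩ := ‹Nonempty (Fin n)›
  -- The difference formula needs subtraction, hence the detour through the integers.
  have hind : indicatorVector ℤ C.toFinset = fun i => (indicatorVector ℕ C.toFinset i : ℤ) := by
    funext i
    simp [indicatorVector]
  have hconst : kupischMatrix σ c *ᵥ indicatorVector ℕ C.toFinset =
      fun _ => (kupischMatrix σ c *ᵥ indicatorVector ℕ C.toFinset) a := by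
    funext b
    refine eq_of_forall_apply_eq hσ (fun i => ?_) b a
    have h := kupischMatrix_mulVec_sub (σ := σ) (c := c) (indicatorVector ℤ C.toFinset) i
    rw [← indicatorVector_pushforward hC, sub_self, sub_eq_zero, hind] at h
    have h' : ∀ i, ((kupischMatrix σ c *ᵥ indicatorVector ℕ C.toFinset) i : ℤ) =
      ((kupischMatrix σ c).map (Nat.cast : ℕ → ℤ) *ᵥ
        fun i => (indicatorVector ℕ C.toFinset i : ℤ)) i :=
      fun i => RingHom.map_mulVec (Nat.castRingHom ℤ) _ _ i
    rw [← h', ← h'] at h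
    exact_mod_cast h
  refine ⟨_, hconst, ?_⟩
  have hsum : ∑ i, (kupischMatrix σ c *ᵥ indicatorVector ℕ C.toFinset) i =
      n * (kupischMatrix σ c *ᵥ indicatorVector ℕ C.toFinset) a := by
    rw [hconst]
    simp
  rw [← hsum]
  simp only [Matrix.mulVec, dotProduct]
  rw [Finset.sum_comm]
  -- Each of the `c j` steps of the path from `j` hits exactly one row.
  have hcol : ∀ j, ∑ i, kupischMatrix σ c i j = c j := by
    intro j
    have : ∀ i, kupischMatrix σ c i j =
        ∑ t ∈ Finset.range (c j), if (σ ^ t) j = i then 1 else 0 := fun i => by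
      simpa using kupischMatrix_eq_sum (R := ℕ) i j
    simp only [this]
    rw [Finset.sum_comm]
    simp
  rw [Finset.sum_congr rfl fun j _ => by rw [← Finset.sum_mul, hcol j]]
  simp [indicatorVector]

/-! ### Lifting to the integers -/

omit hσ in
/-- The lift of `kupischMap` to the integers along the orbit of `a`. -/
def kupischLift (σ : Equiv.Perm (Fin n)) (c : Fin n → ℕ) (a : Fin n) (t : ℤ) : ℤ :=
  t + c ((σ ^ t) a)

omit hσ in
theorem zpow_kupischLift (a : Fin n) (t : ℤ) :
    (σ ^ kupischLift σ c a t) a = kupischMap σ c ((σ ^ t) a) := by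
  rw [kupischLift, add_comm, _root_.zpow_add, zpow_natCast, Equiv.Perm.mul_apply]
  rfl

theorem zpow_eq_zpow_iff (a : Fin n) (s t : ℤ) :
    (σ ^ s) a = (σ ^ t) a ↔ (n : ℤ) ∣ t - s := by
  have hcyc : σ.IsCycleOn ((Finset.univ : Finset (Fin n)) : Set (Fin n)) := by
    rw [Finset.coe_univ]
    exact ⟨Set.bijOn_univ.2 σ.bijective, fun x _ y _ => hσ x y⟩
  have h := hcyc.zpow_apply_eq (Finset.mem_univ a) (n := t - s)
  rw [Finset.card_univ, Fintype.card_fin] at h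
  rw [← h, sub_eq_neg_add, _root_.zpow_add, Equiv.Perm.mul_apply, _root_.zpow_neg, Equiv.Perm.inv_eq_iff_eq,
    eq_comm]

theorem kupischLift_add_mul (a : Fin n) (t k : ℤ) :
    kupischLift σ c a (t + n * k) = kupischLift σ c a t + n * k := by
  have : (σ ^ (t + n * k)) a = (σ ^ t) a := by
    rw [zpow_eq_zpow_iff hσ]
    exact ⟨-k, by ring⟩
  rw [kupischLift, kupischLift, this]
  ring

omit hσ in
-- The increment of the lift at `t` is `c (σ i) + 1 - c i` with `i = (σ ^ t) a`. It is zero exactly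
-- at the vertices that black cycles avoid.
theorem kupischLift_le_succ (hle : ∀ i, c i ≤ c (σ i) + 1) (a : Fin n) (t : ℤ) :
    kupischLift σ c a t ≤ kupischLift σ c a (t + 1) := by
  have h := hle ((σ ^ t) a)
  rw [kupischLift, kupischLift, add_comm t 1, _root_.zpow_add, Equiv.Perm.mul_apply, zpow_one]
  omega

omit hσ in
theorem monotone_kupischLift (hle : ∀ i, c i ≤ c (σ i) + 1) (a : Fin n) :
    Monotone (kupischLift σ c a) :=
  monotone_int_of_le_succ (kupischLift_le_succ hle a)

omit hσ in
theorem zpow_iterate_kupischLift (a : Fin n) (t : ℤ) (m : ℕ) :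
    (σ ^ (kupischLift σ c a)^[m] t) a = (kupischMap σ c)^[m] ((σ ^ t) a) := by
  induction m with
  | zero => rfl
  | succ m ih => rw [Function.iterate_succ_apply', zpow_kupischLift, ih,
      Function.iterate_succ_apply']

omit hσ in
theorem iterate_kupischLift (a : Fin n) (t : ℤ) (m : ℕ) :
    (kupischLift σ c a)^[m] t =
      t + ∑ i ∈ Finset.range m, (c ((kupischMap σ c)^[i] ((σ ^ t) a)) : ℤ) := by
  induction m with
  | zero => simp
  | succ m ih =>
    rw [Function.iterate_succ_apply', kupischLift, zpow_iterate_kupischLift, Finset.sum_range_succ,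
      ih]
    ring

omit hσ in
-- The orbit of a point under a monotone map of a linear order is monotone, so it can return only if
-- it never moves.
theorem eq_self_of_iterate_eq_self {G : ℤ → ℤ} (hG : Monotone G) {t : ℤ} {m : ℕ} (hm : 0 < m)
    (h : G^[m] t = t) : G t = t := by
  rcases le_total t (G t) with h1 | h1
  · have := hG.monotone_iterate_of_le_map h1 (show 1 ≤ m from hm)
    simp only [Function.iterate_one] at this
    omega
  · have := hG.antitone_iterate_of_map_le h1 (show 1 ≤ m from hm)
    simp only [Function.iterate_one] at this
    omega

/-- Two periodic orbits of a monotone degree one map of the integers have the same rotation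
number, and a period of one of them is a period of the other. -/
theorem iterate_kupischMap_eq_self_of_sum_eq (hn : 0 < n) (hle : ∀ i, c i ≤ c (σ i) + 1) {a b : Fin n}
    {p q w₁ w₂ : ℕ} (hq : 0 < q)
    (hw₁ : n * w₁ = ∑ i ∈ Finset.range p, c ((kupischMap σ c)^[i] a))
    (hw₂ : n * w₂ = ∑ i ∈ Finset.range q, c ((kupischMap σ c)^[i] b)) :
    p * w₂ = q * w₁ ∧ (kupischMap σ c)^[p] b = b := by
  set F := kupischLift σ c a with hF
  have hFm : Monotone F := monotone_kupischLift hle a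
  have hadd : ∀ (m : ℕ) (t k : ℤ), F^[m] (t + n * k) = F^[m] t + n * k := by
    intro m
    induction m with
    | zero => intro t k; rfl
    | succ m ih =>
      intro t k
      rw [Function.iterate_succ_apply', ih, hF, kupischLift_add_mul hσ,
        Function.iterate_succ_apply']
  obtain ⟨t₀, ht₀⟩ := hσ a b
  -- Reducing modulo `n` places the lift of `b` between `0` and `n`, which will be fixed points of
  -- `G`.
  obtain ⟨t, ht, ht0, htn⟩ : ∃ t : ℤ, (σ ^ t) a = b ∧ 0 ≤ t ∧ t < n := by
    refine ⟨t₀ % n, ?_, Int.emod_nonneg _ (by omega), Int.emod_lt_of_pos _ (by omega)⟩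
    rw [← ht₀, zpow_eq_zpow_iff hσ]
    exact Int.dvd_self_sub_emod
  have hFa : F^[p] 0 = n * w₁ := by
    rw [hF, iterate_kupischLift]
    simp only [zpow_zero, Equiv.Perm.coe_one, id]
    rw [zero_add]
    exact_mod_cast hw₁.symm
  have hFb : F^[q] t = t + n * w₂ := by
    rw [hF, iterate_kupischLift, ht]
    congr 1
    exact_mod_cast hw₂.symm
  have hFb' : ∀ k : ℕ, (F^[q])^[k] t = t + n * (k * w₂) := by
    intro k
    induction k with
    | zero => simp
    | succ k ih =>
      rw [Function.iterate_succ_apply', ih, hadd, hFb]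
      push_cast
      ring
  -- The translate of `F^[p]` that fixes `0`. It commutes with translation by `n`, so it fixes `n`
  -- too and maps the interval from `0` to `n` into itself.
  set G : ℤ → ℤ := fun x => F^[p] x - n * w₁ with hG
  have hGm : Monotone G := fun x y hxy => sub_le_sub_right (hFm.iterate p hxy) _
  have hGit : ∀ (k : ℕ) (x : ℤ), G^[k] x = (F^[p])^[k] x - n * (k * w₁) := by
    intro k
    induction k with
    | zero => intro x; simp
    | succ k ih =>
      intro x
      rw [Function.iterate_succ_apply', Function.iterate_succ_apply', ih, hG]
      have := hadd p ((F^[p])^[k] x - n * (k * w₁)) (k * w₁)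
      rw [sub_add_cancel] at this
      simp only
      rw [this]
      push_cast
      ring
  have hG0 : G 0 = 0 := by simp [hG, hFa]
  have hGn : G n = n := by
    have := hadd p 0 1
    simp only [zero_add, mul_one] at this
    simp [hG, this, hFa]
  have hbound : ∀ k : ℕ, 0 ≤ G^[k] t ∧ G^[k] t ≤ n := by
    intro k
    induction k with
    | zero => exact ⟨ht0, htn.le⟩
    | succ k ih =>
      rw [Function.iterate_succ_apply']
      exact ⟨hG0.symm.le.trans (hGm ih.1), (hGm ih.2).trans hGn.le⟩
  have hGk : ∀ k : ℕ, G^[q * k] t = t + k * (n * (p * w₂ - q * w₁)) := by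
    intro k
    have hcomm : (F^[p])^[q * k] t = (F^[q])^[p * k] t := by
      rw [← Function.iterate_mul, ← Function.iterate_mul]
      congr 1
      ring
    rw [hGit, hcomm, hFb']
    push_cast
    ring
  have hD : (p * w₂ - q * w₁ : ℤ) = 0 := by
    by_contra hne
    -- Two rounds are used because a single one would not exclude the displacement from `0` to `n`.
    -- A displacement of at least `2 * n` leaves the interval.
    have hb := hbound (q * 2)
    rw [hGk 2] at hb
    have hb1 := hbound (q * 1)
    rcases lt_or_gt_of_ne hne with hlt | hgt
    · have : (n : ℤ) * (p * w₂ - q * w₁) ≤ n * (-1) :=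
        mul_le_mul_of_nonneg_left (by omega) (by omega)
      push_cast at hb
      omega
    · have : (n : ℤ) * 1 ≤ n * (p * w₂ - q * w₁) :=
        mul_le_mul_of_nonneg_left (by omega) (by omega)
      push_cast at hb
      omega
  refine ⟨by zify; omega, ?_⟩
  have hGt : G^[q] t = t := by
    have := hGk 1
    rw [hD] at this
    simpa using this
  have hfix : F^[p] t = t + n * w₁ := by
    have := eq_self_of_iterate_eq_self hGm hq hGt
    simp only [hG] at this
    omega
  have := zpow_iterate_kupischLift (σ := σ) (c := c) a t p
  rw [← hF, hfix, ht] at this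
  rw [← this, ← ht, zpow_eq_zpow_iff hσ]
  exact ⟨-w₁, by ring⟩

/-- Each minimal period is a period of the other orbit, so the two are equal and cancel from the
equality of rotation numbers. -/
theorem weight_eq_of_mem_functionalCycles (hn : 0 < n) (hle : ∀ i, c i ≤ c (σ i) + 1)
    {C C' : Cycle (Fin n)} (hC : C ∈ functionalCycles (kupischMap σ c))
    (hC' : C' ∈ functionalCycles (kupischMap σ c)) {w w' : ℕ}
    (hw : n * w = ∑ i ∈ C.toFinset, c i) (hw' : n * w' = ∑ i ∈ C'.toFinset, c i) : w = w' := by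
  obtain ⟨a, ha⟩ := exists_mem_of_mem_functionalCycles hC
  obtain ⟨b, hb⟩ := exists_mem_of_mem_functionalCycles hC'
  obtain ⟨hpa, rfl⟩ := eq_periodicOrbit_of_mem hC ha
  obtain ⟨hpb, rfl⟩ := eq_periodicOrbit_of_mem hC' hb
  rw [sum_toFinset_periodicOrbit] at hw hw'
  have hp := Function.minimalPeriod_pos_of_mem_periodicPts hpa
  have hq := Function.minimalPeriod_pos_of_mem_periodicPts hpb
  obtain ⟨h1, h2⟩ := iterate_kupischMap_eq_self_of_sum_eq hσ hn hle hq hw hw'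
  obtain ⟨-, h3⟩ := iterate_kupischMap_eq_self_of_sum_eq hσ hn hle hp hw' hw
  have h4 := Nat.dvd_antisymm (Function.IsPeriodicPt.minimalPeriod_dvd h2)
    (Function.IsPeriodicPt.minimalPeriod_dvd h3)
  rw [h4] at h1
  exact (Nat.eq_of_mul_eq_mul_left hp h1).symm

/-! ### Black cycles -/

/-- Entry `j` counts the points of the cycle on the path of length `c j` from `j`. Compared with the
path from `σ j`, it gains `j` and loses the positions in `Ico (c j) (c (σ j) + 1)`, that is, from `F
0` up to but excluding `F 1` for the lift `F` based at `j`. Blackness ensures that these positions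
contain a point of the cycle exactly when `j` is on it, and then only one, so gain and loss cancel.
-/
theorem exists_transpose_mulVec_eq_const [Nonempty (Fin n)] (hle : ∀ i, c i ≤ c (σ i) + 1)
    {C : Cycle (Fin n)} (hC : C ∈ functionalCycles (kupischMap σ c))
    (hblack : ∀ i ∈ C, c i ≠ c (σ i) + 1) :
    ∃ w : ℕ, (kupischMatrix σ c)ᵀ *ᵥ indicatorVector ℕ C.toFinset = fun _ => w := by
  obtain ⟨a⟩ := ‹Nonempty (Fin n)›
  refine ⟨((kupischMatrix σ c)ᵀ *ᵥ indicatorVector ℕ C.toFinset) a, ?_⟩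
  funext b
  refine eq_of_forall_apply_eq hσ (fun j => ?_) b a
  have hT : ∀ j, ((kupischMatrix σ c)ᵀ *ᵥ indicatorVector ℕ C.toFinset) j =
      ∑ t ∈ Finset.range (c j), indicatorVector ℕ C.toFinset ((σ ^ t) j) := fun j =>
    kupischMatrix_transpose_mulVec (R := ℕ) (σ := σ) (c := c) (indicatorVector ℕ C.toFinset) j
  rw [hT, hT]
  have h1 : ∑ t ∈ Finset.range (c (σ j) + 1), indicatorVector ℕ C.toFinset ((σ ^ t) j) =
      ∑ t ∈ Finset.range (c (σ j)), indicatorVector ℕ C.toFinset ((σ ^ t) (σ j)) +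
        indicatorVector ℕ C.toFinset j := by
    rw [Finset.sum_range_succ']
    simp [pow_succ, Equiv.Perm.mul_apply]
  have h2 := Finset.sum_range_add_sum_Ico
    (fun t => indicatorVector ℕ C.toFinset ((σ ^ t) j)) (hle j)
  have h3 : ∑ t ∈ Finset.Ico (c j) (c (σ j) + 1), indicatorVector ℕ C.toFinset ((σ ^ t) j) =
      indicatorVector ℕ C.toFinset j := by
    have hone : ∀ r ∈ Finset.Ico (c j) (c (σ j) + 1), (σ ^ r) j ∈ C → r = c j ∧ j ∈ C := by
      intro r hr hrC
      rw [Finset.mem_Ico] at hr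
      -- A position `r` on the cycle is `F s` for some `s` lying over the cycle. Monotonicity gives
      -- `s ≤ 0`.
      obtain ⟨y, hy, hyr⟩ := exists_mem_map_eq hC hrC
      obtain ⟨s₀, rfl⟩ := hσ j y
      rw [← zpow_kupischLift, ← zpow_natCast, zpow_eq_zpow_iff hσ] at hyr
      obtain ⟨k, hk⟩ := hyr
      have hs : (σ ^ (s₀ + n * k)) j = (σ ^ s₀) j := by
        rw [zpow_eq_zpow_iff hσ]
        exact ⟨-k, by ring⟩
      rw [← hs] at hy
      set s := s₀ + n * k with hsdef
      have hFs : kupischLift σ c j s = r := by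
        rw [hsdef, kupischLift_add_mul hσ, ← hk]
        ring
      have hF0 : kupischLift σ c j 0 = c j := by simp [kupischLift]
      have hF1 : kupischLift σ c j 1 = c (σ j) + 1 := by simp [kupischLift, add_comm]
      have hs0 : s ≤ 0 := by
        by_contra hlt
        have := monotone_kupischLift hle j (show 1 ≤ s by omega)
        omega
      rcases hs0.lt_or_eq with hlt | heq
      · exfalso
        -- If `s < 0`, then `F s ≤ F (s + 1) ≤ F 0 ≤ r = F s`. The lift is stationary at `s`, which
        -- contradicts blackness there.
        have h4 := monotone_kupischLift hle j (show s + 1 ≤ 0 by omega)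
        have h5 := kupischLift_le_succ hle j s
        have h6 : kupischLift σ c j (s + 1) = kupischLift σ c j s := by omega
        rw [kupischLift, kupischLift, add_comm s 1, _root_.zpow_add, Equiv.Perm.mul_apply, zpow_one] at h6
        exact hblack _ hy (by omega)
      · rw [heq] at hy hFs
        exact ⟨by omega, hy⟩
    by_cases hj : j ∈ C
    · have hlt : c j < c (σ j) + 1 := lt_of_le_of_ne (hle j) (hblack j hj)
      rw [Finset.sum_eq_single_of_mem (c j) (by simpa using hlt)]
      · have : (σ ^ c j) j ∈ C := map_mem_of_mem hC hj
        simp [indicatorVector, mem_cycle_toFinset, this, hj]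
      · intro r hr hne
        have : (σ ^ r) j ∉ C := fun h => hne (hone r hr h).1
        simp [indicatorVector, mem_cycle_toFinset, this]
    · rw [Finset.sum_eq_zero]
      · simp [indicatorVector, mem_cycle_toFinset, hj]
      · intro r hr
        have : (σ ^ r) j ∉ C := fun h => hj (hone r hr h).2
        simp [indicatorVector, mem_cycle_toFinset, this]
  omega

/-- The constants for the matrix and its transpose agree because both, times the number of vertices
of the cycle, compute the same quadratic form at its indicator vector. -/
theorem transpose_mulVec_indicatorVector [Nonempty (Fin n)] (hle : ∀ i, c i ≤ c (σ i) + 1)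
    {C : Cycle (Fin n)} (hC : C ∈ functionalCycles (kupischMap σ c))
    (hblack : ∀ i ∈ C, c i ≠ c (σ i) + 1) {w : ℕ}
    (hw : kupischMatrix σ c *ᵥ indicatorVector ℕ C.toFinset = fun _ => w) :
    (kupischMatrix σ c)ᵀ *ᵥ indicatorVector ℕ C.toFinset = fun _ => w := by
  obtain ⟨w', hw'⟩ := exists_transpose_mulVec_eq_const hσ hle hC hblack
  obtain ⟨a, ha⟩ := exists_mem_of_mem_functionalCycles hC
  have h1 := Matrix.dotProduct_mulVec (indicatorVector ℕ C.toFinset) (kupischMatrix σ c)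
    (indicatorVector ℕ C.toFinset)
  rw [← Matrix.mulVec_transpose, hw, hw', dotProduct_comm] at h1
  have h2 : ∀ m : ℕ, (fun _ => m) ⬝ᵥ indicatorVector ℕ C.toFinset = m * C.toFinset.card := by
    intro m
    simp [dotProduct, indicatorVector, mul_comm]
  rw [h2, h2] at h1
  have hpos : 0 < C.toFinset.card := Finset.card_pos.2 ⟨a, mem_cycle_toFinset.2 ha⟩
  rw [hw', Nat.eq_of_mul_eq_mul_right hpos h1]

end Kupisch

/-! ### Solutions of the linear systems for a Kupisch series -/

section KupischMain

variable {n : ℕ} {σ : Equiv.Perm (Fin n)} {c : Fin n → ℕ}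

theorem map_mulVec_indicatorVector {R : Type*} [Semiring R] {M : Matrix (Fin n) (Fin n) ℕ}
    {X : Finset (Fin n)} {w : ℕ} (h : M *ᵥ indicatorVector ℕ X = fun _ => w) :
    M.map (Nat.cast : ℕ → R) *ᵥ indicatorVector R X = fun _ => (w : R) := by
  have hind : indicatorVector R X = fun i => (indicatorVector ℕ X i : R) := by
    funext i
    simp [indicatorVector]
  funext i
  rw [hind]
  have := RingHom.map_mulVec (Nat.castRingHom R) M (indicatorVector ℕ X) i
  rw [h] at this
  exact this.symm

/-- Since `w ≠ 0`, the support of `ξ` is nonempty, so `ξ` dominates the indicator of some cycle. The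
difference is a natural vector killed by a matrix with natural entries and positive diagonal, hence
zero. -/
theorem eq_indicatorVector_of_mulVec_eq (hc : ∀ i, 1 ≤ c i) {w : ℕ} (hw : w ≠ 0) (hn : 0 < n)
    (hcyc : ∀ C ∈ functionalCycles (kupischMap σ c),
      kupischMatrix σ c *ᵥ indicatorVector ℕ C.toFinset = fun _ => w)
    {ξ : Fin n → ℕ} (hξ : kupischMatrix σ c *ᵥ ξ = fun _ => w) :
    ∃ C ∈ functionalCycles (kupischMap σ c), indicatorVector ℕ C.toFinset = ξ := by
  have hpush : ∀ i, ((ξ i : ℕ) : ℤ) = ∑ j with kupischMap σ c j = i, ((ξ j : ℕ) : ℤ) := by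
    refine pushforward_of_mulVec_eq_const (w := (w : ℤ)) (σ := σ) (c := c)
      (ξ := fun i => ((ξ i : ℕ) : ℤ)) ?_
    funext i
    have := RingHom.map_mulVec (Nat.castRingHom ℤ) (kupischMatrix σ c) ξ i
    rw [hξ] at this
    exact this.symm
  have hpush' : ∀ i, ξ i = ∑ j with kupischMap σ c j = i, ξ j := fun i => by
    exact_mod_cast hpush i
  obtain ⟨i, hi⟩ : ∃ i, ξ i ≠ 0 := by
    by_contra! h
    have h0 : ξ = 0 := funext h
    rw [h0, Matrix.mulVec_zero] at hξ
    exact hw (congrFun hξ ⟨0, hn⟩).symm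
  have hp := mem_periodicPts_of_pushforward hpush' hi
  have hC := periodicOrbit_mem_functionalCycles hp
  refine ⟨_, hC, ?_⟩
  set C := Function.periodicOrbit (kupischMap σ c) i
  have hle : ∀ j, indicatorVector ℕ C.toFinset j ≤ ξ j := by
    intro j
    by_cases hj : j ∈ C
    · rw [eq_of_pushforward hpush' hC hj (Function.self_mem_periodicOrbit hp)]
      simp only [indicatorVector, mem_cycle_toFinset, hj, if_true]
      omega
    · simp [indicatorVector, mem_cycle_toFinset, hj]
  have hdiff : ξ = indicatorVector ℕ C.toFinset + (ξ - indicatorVector ℕ C.toFinset) := by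
    funext j
    have := hle j
    simp only [Pi.add_apply, Pi.sub_apply]
    omega
  rw [hdiff, Matrix.mulVec_add, hcyc C hC] at hξ
  rw [hdiff]
  funext j
  have h1 := congrFun hξ j
  simp only [Pi.add_apply, add_eq_left, Matrix.mulVec, dotProduct] at h1
  have h2 := (Finset.sum_eq_zero_iff.1 h1) j (Finset.mem_univ _)
  have h3 := one_le_kupischMatrix_self (σ := σ) hc j
  rcases Nat.mul_eq_zero.1 h2 with h4 | h4
  · omega
  · rw [Pi.add_apply, h4, add_zero]

/-- The solutions of the linear systems of the Cartan matrix, for a cyclic order `σ` and a Kupisch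
series `c`. -/
theorem kupisch_cycles_and_solutions (hn : 0 < n) (hσ : ∀ x y, σ.SameCycle x y)
    (hc : ∀ i, 1 ≤ c i) (hle : ∀ i, c i ≤ c (σ i) + 1) {cyc black : Set (Cycle (Fin n))}
    (hcyc : cyc = functionalCycles (kupischMap σ c))
    (hblack : black = {C | C ∈ cyc ∧ ∀ i ∈ C, c i ≠ c (σ i) + 1}) :
    ∃ w : ℕ,
      cyc.Nonempty ∧
      (∀ C ∈ cyc, (∑ i ∈ C.toFinset, (c i : ℚ) / n) = w) ∧
      (∀ (K : Type v) [Field K] [CharZero K],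
        IsMaximalIndependentIn K
          (fun C : cyc => indicatorVector K (C : Cycle (Fin n)).toFinset)
          {ξ : Fin n → K |
            (kupischMatrix σ c).map (Nat.cast : ℕ → K) *ᵥ ξ = fun _ => (w : K)}) ∧
      {ξ : Fin n → ℕ | kupischMatrix σ c *ᵥ ξ = fun _ => w} =
        (fun C : Cycle (Fin n) => indicatorVector ℕ C.toFinset) '' cyc ∧
      (∀ (K : Type v) [Field K] [CharZero K],
        IsMaximalIndependentIn K
          (fun C : black => indicatorVector K (C : Cycle (Fin n)).toFinset)
          {ξ : Fin n → K |
            ((kupischMatrix σ c)ᵀ.map (Nat.cast : ℕ → K) *ᵥ ξ = fun _ => (w : K)) ∧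
            ((kupischMatrix σ c).map (Nat.cast : ℕ → K) *ᵥ ξ = fun _ => (w : K))}) := by
  have : Nonempty (Fin n) := ⟨⟨0, hn⟩⟩
  subst hcyc
  obtain ⟨C₀, hC₀⟩ := functionalCycles_nonempty (f := kupischMap σ c)
  obtain ⟨w, hw, hsum⟩ := exists_mulVec_indicatorVector_eq_const hσ hC₀
  have hall : ∀ C ∈ functionalCycles (kupischMap σ c),
      (kupischMatrix σ c *ᵥ indicatorVector ℕ C.toFinset = fun _ => w) ∧
        n * w = ∑ i ∈ C.toFinset, c i := by
    intro C hC
    obtain ⟨w', hw', hsum'⟩ := exists_mulVec_indicatorVector_eq_const hσ hC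
    obtain rfl := weight_eq_of_mem_functionalCycles hσ hn hle hC₀ hC hsum hsum'
    exact ⟨hw', hsum'⟩
  have hw0 : w ≠ 0 := by
    rintro rfl
    obtain ⟨a, ha⟩ := exists_mem_of_mem_functionalCycles hC₀
    have h1 := Finset.sum_eq_zero_iff.1 (hsum.symm.trans (mul_zero n)) a
      (mem_cycle_toFinset.2 ha)
    have := hc a
    omega
  have hT : black ⊆ functionalCycles (kupischMap σ c) := by
    rw [hblack]
    exact fun C hC => hC.1
  refine ⟨w, ⟨C₀, hC₀⟩, fun C hC => ?_, fun K _ _ => ?_, ?_, fun K _ _ => ?_⟩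
  · rw [← Finset.sum_div, div_eq_iff (by exact_mod_cast hn.ne')]
    have := (hall C hC).2
    rw [mul_comm]
    exact_mod_cast this.symm
  · refine isMaximalIndependentIn_of_subset_span (fun C => ?_)
      (linearIndependent_indicatorVector subset_rfl) fun ξ hξ => ?_
    · exact map_mulVec_indicatorVector (hall C C.2).1
    · exact mem_span_indicatorVector subset_rfl (pushforward_of_mulVec_eq_const hξ)
        fun C hC hC' => absurd hC hC'
  · ext ξ
    constructor
    · intro hξ
      exact eq_indicatorVector_of_mulVec_eq hc hw0 hn (fun C hC => (hall C hC).1) hξ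
    · rintro ⟨C, hC, rfl⟩
      exact (hall C hC).1
  · refine isMaximalIndependentIn_of_subset_span (fun C => ?_)
      (linearIndependent_indicatorVector hT) fun ξ hξ => ?_
    · have hC := hblack.subset C.2
      exact ⟨map_mulVec_indicatorVector
        (transpose_mulVec_indicatorVector hσ hle hC.1 hC.2 (hall C hC.1).1),
        map_mulVec_indicatorVector (hall C hC.1).1⟩
    · have hp := pushforward_of_mulVec_eq_const hξ.2
      refine mem_span_indicatorVector hT hp fun C hC hC' i hi => ?_
      rw [hblack] at hC'
      obtain ⟨j, hj, hcj⟩ : ∃ j ∈ C, c j = c (σ j) + 1 := by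
        by_contra! h
        exact hC' ⟨hC, h⟩
      rw [eq_of_pushforward hp hC hi hj]
      -- The path from `j` is `j` followed by the whole path from `σ j`, so equality of these two
      -- entries leaves `ξ j = 0`.
      have h1 := congrFun hξ.1 j
      have h2 := congrFun hξ.1 (σ j)
      rw [kupischMatrix_transpose_mulVec] at h1 h2
      rw [hcj, Finset.sum_range_succ'] at h1
      simp only [pow_succ, Equiv.Perm.mul_apply] at h1
      rw [h2] at h1
      simpa using h1

end KupischMain

/-! ### Projective covers of simple modules -/

section Uniserial

variable {R : Type*} [Ring R] {M : Type*} [AddCommGroup M] [Module R M]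

theorem _root_.IsCoatom.le_of_isUniserial (hM : IsUniserial R M) {K N : Submodule R M} (hK : IsCoatom K)
    (hN : N ≠ ⊤) : N ≤ K := by
  rcases hM N K with h | h
  · exact h
  · rcases hK.le_iff.1 h with h | h
    · exact absurd h hN
    · exact h.le

theorem IsUniserial.submodule (hM : IsUniserial R M) (K : Submodule R M) : IsUniserial R K := by
  intro N N'
  rcases hM (N.map K.subtype) (N'.map K.subtype) with h | h
  · exact Or.inl ((Submodule.map_le_map_iff_of_injective K.injective_subtype _ _).1 h)
  · exact Or.inr ((Submodule.map_le_map_iff_of_injective K.injective_subtype _ _).1 h)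

end Uniserial

section Cover

variable {A : Type u} [Ring A] {P S : Type u} [AddCommGroup P] [Module A P] [AddCommGroup S]
  [Module A S] {π : P →ₗ[A] S}

namespace IsProjectiveCover

theorem isCoatom_ker [IsSimpleModule A S] (h : IsProjectiveCover π) :
    IsCoatom (LinearMap.ker π) :=
  LinearMap.isCoatom_ker_of_surjective h.surjective

/-- The kernel is maximal and superfluous, hence it is the largest proper submodule. It plays the
role of the radical of `P` throughout. -/
theorem le_ker [IsSimpleModule A S] (h : IsProjectiveCover π) {N : Submodule A P} (hN : N ≠ ⊤) :
    N ≤ LinearMap.ker π := by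
  rcases h.isCoatom_ker.le_iff.1 (le_sup_right : _ ≤ N ⊔ LinearMap.ker π) with h1 | h1
  · exact absurd (h.superfluous N h1) hN
  · exact le_sup_left.trans h1.le

theorem eq_top_of_mem [IsSimpleModule A S] (h : IsProjectiveCover π) {N : Submodule A P} {x : P}
    (hx : x ∈ N) (hπx : π x ≠ 0) : N = ⊤ := by
  by_contra hN
  exact hπx (h.le_ker hN hx)

theorem nontrivial [IsSimpleModule A S] (h : IsProjectiveCover π) : Nontrivial P := by
  have := IsSimpleModule.nontrivial A S
  exact h.surjective.nontrivial

theorem exists_ne_zero [IsSimpleModule A S] (h : IsProjectiveCover π) : ∃ x, π x ≠ 0 := by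
  have := IsSimpleModule.nontrivial A S
  obtain ⟨y, hy⟩ := exists_ne (0 : S)
  obtain ⟨x, rfl⟩ := h.surjective y
  exact ⟨x, hy⟩

/-- The projective cover of a simple module is isomorphic to a principal left ideal generated by an
idempotent: there is a generator `x` and a linear section `s` of `a ↦ a • x`. -/
theorem exists_generator [IsSimpleModule A S] (h : IsProjectiveCover π) :
    ∃ (x : P) (s : P →ₗ[A] A), π x ≠ 0 ∧ ∀ p, s p • x = p := by
  obtain ⟨x, hx⟩ := h.exists_ne_zero
  have hsurj : Function.Surjective (LinearMap.toSpanSingleton A P x) := by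
    rw [← LinearMap.range_eq_top]
    exact h.eq_top_of_mem (x := x) ⟨1, by simp⟩ hx
  have := h.projective
  obtain ⟨s, hs⟩ := Module.projective_lifting_property _ LinearMap.id hsurj
  exact ⟨x, s, hx, fun p => by simpa using LinearMap.congr_fun hs p⟩

theorem finite [IsSimpleModule A S] (h : IsProjectiveCover π) : Module.Finite A P := by
  obtain ⟨x, s, -, hs⟩ := h.exists_generator
  exact Module.Finite.of_surjective (LinearMap.toSpanSingleton A P x) fun p => ⟨s p, hs p⟩

theorem isIndecomposable [IsSimpleModule A S] (h : IsProjectiveCover π) :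
    IsIndecomposable A P := by
  refine ⟨h.nontrivial, fun N N' hc => ?_⟩
  by_contra! hne
  have h1 : N ≠ ⊤ := fun hN => hne.2 (by simpa [hN] using hc.disjoint)
  have h2 : N' ≠ ⊤ := fun hN => hne.1 (by simpa [hN] using hc.disjoint)
  have h3 := sup_le (h.le_ker h1) (h.le_ker h2)
  rw [hc.sup_eq_top] at h3
  exact h.isCoatom_ker.1 (top_le_iff.1 h3)

/-- A linear map from the projective cover of `S` to a simple module is zero unless that module is
isomorphic to `S`. -/
theorem nonempty_equiv_of_ne_zero [IsSimpleModule A S] (h : IsProjectiveCover π) {T : Type*}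
    [AddCommGroup T] [Module A T] [IsSimpleModule A T] {f : P →ₗ[A] T} (hf : f ≠ 0) :
    Nonempty (T ≃ₗ[A] S) := by
  have hsurj := LinearMap.surjective_of_ne_zero hf
  have hker : LinearMap.ker f = LinearMap.ker π := by
    have h1 := LinearMap.isCoatom_ker_of_surjective hsurj
    exact (h1.le_iff_eq h.isCoatom_ker.1).1 (h.le_ker h1.1) |>.symm
  exact ⟨(f.quotKerEquivOfSurjective hsurj).symm ≪≫ₗ Submodule.quotEquivOfEq _ _ hker ≪≫ₗ
    π.quotKerEquivOfSurjective h.surjective⟩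

theorem projective_iff_ker_eq_bot [IsSimpleModule A S] (h : IsProjectiveCover π) :
    Module.Projective A S ↔ LinearMap.ker π = ⊥ := by
  constructor
  · intro hp
    obtain ⟨t, ht⟩ := Module.projective_lifting_property π LinearMap.id h.surjective
    obtain ⟨x, hx⟩ := h.exists_ne_zero
    have htop : LinearMap.range t = ⊤ := by
      refine h.eq_top_of_mem (x := t (π x)) ⟨_, rfl⟩ ?_
      have := LinearMap.congr_fun ht (π x)
      simp only [LinearMap.comp_apply, LinearMap.id_apply] at this
      rwa [this]
    rw [LinearMap.ker_eq_bot']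
    intro p hp
    obtain ⟨y, rfl⟩ := LinearMap.range_eq_top.1 htop p
    have := LinearMap.congr_fun ht y
    simp only [LinearMap.comp_apply, LinearMap.id_apply] at this
    rw [← this, hp, map_zero]
  · intro hk
    have := h.projective
    exact Module.Projective.of_equiv
      (LinearEquiv.ofBijective π ⟨LinearMap.ker_eq_bot.1 hk, h.surjective⟩)

end IsProjectiveCover

theorem IsProjectiveCover.isUniserial
    [IsSimpleModule A S] (h : IsProjectiveCover π) (hA : IsSerialRing A) : IsUniserial A P :=
  have := h.projective
  have := h.finite
  hA P h.isIndecomposable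

/-! ### Uniserial right ideals -/

section Right

open MulOpposite

theorem mem_span_op_iff {e : A} (he : e * e = e) (y : Aᵐᵒᵖ) :
    y ∈ Submodule.span Aᵐᵒᵖ {op e} ↔ e * unop y = unop y := by
  rw [Submodule.mem_span_singleton]
  constructor
  · rintro ⟨c, rfl⟩
    simp [← mul_assoc, he]
  · intro h
    exact ⟨y, by rw [smul_eq_mul]; exact unop_injective (by simpa using h)⟩

/-- The right ideal generated by the idempotent of the projective cover of a simple module is
indecomposable. -/
theorem IsProjectiveCover.isIndecomposable_span_op [IsSimpleModule A S] (h : IsProjectiveCover π)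
    {x : P} {s : P →ₗ[A] A} (hx : π x ≠ 0) (hs : ∀ p, s p • x = p) :
    IsIndecomposable Aᵐᵒᵖ (Submodule.span Aᵐᵒᵖ {op (s x)}) := by
  set e := s x with he_def
  have hsp : ∀ p, s p * e = s p := fun p => by
    rw [he_def, ← smul_eq_mul, ← map_smul, hs]
  have he : e * e = e := hsp x
  have hex : e • x = x := hs x
  -- A decomposition of `eA` splits `e` into orthogonal idempotents `e₁ + e₂`. If `e₁ • x` lies
  -- outside the radical it generates `P`, so `e₂ = r * e₁` for some `r`. Then `e₂ = e₂ * e₂ = r *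
  -- e₁ * e₂ = 0`.
  have key : ∀ N N' : Submodule Aᵐᵒᵖ (Submodule.span Aᵐᵒᵖ {op e}), IsCompl N N' →
      ∀ (e₁ e₂ : A) (h₁ : op e₁ ∈ Submodule.span Aᵐᵒᵖ {op e})
        (h₂ : op e₂ ∈ Submodule.span Aᵐᵒᵖ {op e}), e₁ + e₂ = e →
        (⟨op e₁, h₁⟩ : Submodule.span Aᵐᵒᵖ {op e}) ∈ N →
        (⟨op e₂, h₂⟩ : Submodule.span Aᵐᵒᵖ {op e}) ∈ N' → π (e₁ • x) ≠ 0 → N' = ⊥ := by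
    intro N N' hc e₁ e₂ h₁ h₂ hsum hN hN' hne
    have he₁ : e * e₁ = e₁ := by simpa using (mem_span_op_iff he _).1 h₁
    have he₂ : e * e₂ = e₂ := by simpa using (mem_span_op_iff he _).1 h₂
    have hzero : ∀ z : Submodule.span Aᵐᵒᵖ {op e}, z ∈ N → z ∈ N' → z = 0 := fun z hz hz' => by
      have : z ∈ N ⊓ N' := ⟨hz, hz'⟩
      rwa [hc.inf_eq_bot, Submodule.mem_bot] at this
    have h12 : e₁ * e₂ = 0 := by
      have hA : op e₂ • (⟨op e₁, h₁⟩ : Submodule.span Aᵐᵒᵖ {op e}) ∈ N := N.smul_mem _ hN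
      have hB : op e₂ • (⟨op e₁, h₁⟩ : Submodule.span Aᵐᵒᵖ {op e}) =
          ⟨op e₂, h₂⟩ - op e₂ • (⟨op e₂, h₂⟩ : Submodule.span Aᵐᵒᵖ {op e}) := by
        apply Subtype.ext
        apply unop_injective
        simp only [Submodule.coe_smul, smul_eq_mul, unop_mul, unop_op, AddSubgroupClass.coe_sub,
          unop_sub]
        nth_rewrite 2 [← he₂]
        rw [← hsum]
        noncomm_ring
      have := hzero _ hA (hB ▸ N'.sub_mem hN' (N'.smul_mem _ hN'))
      exact congrArg (fun z : Submodule.span Aᵐᵒᵖ {op e} => unop (z : Aᵐᵒᵖ)) this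
    have h11 : e₁ * e = e₁ := by
      have hA : op e₁ • (⟨op e₂, h₂⟩ : Submodule.span Aᵐᵒᵖ {op e}) ∈ N' := N'.smul_mem _ hN'
      have hB : op e₁ • (⟨op e₂, h₂⟩ : Submodule.span Aᵐᵒᵖ {op e}) =
          ⟨op e₁, h₁⟩ - op e₁ • (⟨op e₁, h₁⟩ : Submodule.span Aᵐᵒᵖ {op e}) := by
        apply Subtype.ext
        apply unop_injective
        simp only [Submodule.coe_smul, smul_eq_mul, unop_mul, unop_op, AddSubgroupClass.coe_sub,
          unop_sub]
        nth_rewrite 2 [← he₁]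
        rw [← hsum]
        noncomm_ring
      have h0 := hzero _ (hB ▸ N.sub_mem hN (N.smul_mem _ hN)) hA
      have h21 : e₂ * e₁ = 0 :=
        congrArg (fun z : Submodule.span Aᵐᵒᵖ {op e} => unop (z : Aᵐᵒᵖ)) h0
      calc e₁ * e = e₁ * e₁ + e₁ * e₂ := by rw [← hsum, mul_add]
        _ = e₁ * e₁ + e₂ * e₁ := by rw [h12, h21]
        _ = e * e₁ := by rw [← hsum, add_mul]
        _ = e₁ := he₁
    have h22 : e₂ * e = e₂ := by
      have : e₂ = e - e₁ := by rw [← hsum]; abel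
      rw [this, sub_mul, he, h11]
    have htop := h.eq_top_of_mem (Submodule.mem_span_singleton_self (R := A) (e₁ • x)) hne
    have hmem : e₂ • x ∈ Submodule.span A {e₁ • x} := htop ▸ Submodule.mem_top
    obtain ⟨r, hr⟩ := Submodule.mem_span_singleton.1 hmem
    have hr' : r * e₁ = e₂ := by
      have := congrArg s hr
      simp only [map_smul, smul_eq_mul, ← he_def] at this
      rwa [h11, h22] at this
    have h2 : e₂ = 0 := by
      calc e₂ = e * e₂ := he₂.symm
        _ = e₁ * e₂ + e₂ * e₂ := by rw [← hsum, add_mul]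
        _ = 0 + r * e₁ * e₂ := by rw [h12, hr']
        _ = 0 := by rw [mul_assoc, h12, mul_zero, add_zero]
    have h1e : e₁ = e := by rw [← hsum, h2, add_zero]
    rw [Submodule.eq_bot_iff]
    intro z hz
    refine hzero z ?_ hz
    have hz' : z = (z : Aᵐᵒᵖ) • (⟨op e₁, h₁⟩ : Submodule.span Aᵐᵒᵖ {op e}) := by
      apply Subtype.ext
      apply unop_injective
      have := (mem_span_op_iff he _).1 z.2
      simp only [Submodule.coe_smul, smul_eq_mul, unop_mul, unop_op, h1e]
      exact this.symm
    rw [hz']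
    exact N.smul_mem _ hN
  constructor
  · refine ⟨⟨op e, Submodule.mem_span_singleton_self _⟩, 0, fun h0 => hx ?_⟩
    have : e = 0 := congrArg (fun z : Submodule.span Aᵐᵒᵖ {op e} => unop (z : Aᵐᵒᵖ)) h0
    rw [← hex, this, zero_smul, map_zero]
  · intro N N' hc
    have hmem : (⟨op e, Submodule.mem_span_singleton_self _⟩ : Submodule.span Aᵐᵒᵖ {op e}) ∈
        N ⊔ N' := hc.sup_eq_top ▸ Submodule.mem_top
    obtain ⟨⟨y, hy⟩, hyN, ⟨y', hy'⟩, hyN', hsum⟩ := Submodule.mem_sup.1 hmem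
    have hsum' : unop y + unop y' = e :=
      congrArg (fun z : Submodule.span Aᵐᵒᵖ {op e} => unop (z : Aᵐᵒᵖ)) hsum
    -- The two images sum to `π x ≠ 0`, so one of the two components can play the role of `e₁`.
    have hπ : π (unop y • x) + π (unop y' • x) ≠ 0 := by
      rwa [← map_add, ← add_smul, hsum', hex]
    by_cases h1 : π (unop y • x) = 0
    · left
      rw [h1, zero_add] at hπ
      exact key N' N hc.symm (unop y') (unop y) hy' hy (by rw [add_comm, hsum']) hyN' hyN hπ
    · right
      exact key N N' hc (unop y) (unop y') hy hy' hsum' hyN hyN' h1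

theorem isUniserial_span_op {A : Type u} [Ring A] (hA : IsSerialRing Aᵐᵒᵖ) {e : A} (he : e * e = e)
    (hind : IsIndecomposable Aᵐᵒᵖ (Submodule.span Aᵐᵒᵖ {op e})) :
    IsUniserial Aᵐᵒᵖ (Submodule.span Aᵐᵒᵖ {op e}) := by
  have : Module.Projective Aᵐᵒᵖ (Submodule.span Aᵐᵒᵖ {op e}) := by
    refine Module.Projective.of_split (Submodule.subtype _)
      ((LinearMap.toSpanSingleton Aᵐᵒᵖ Aᵐᵒᵖ (op e)).codRestrict _
        fun c => Submodule.smul_mem _ _ (Submodule.mem_span_singleton_self _)) ?_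
    ext ⟨y, hy⟩
    have := (mem_span_op_iff he _).1 hy
    apply unop_injective
    exact this
  exact hA _ hind

/-- Over a right Nakayama ring, two maps from the projective cover of a simple module to the ring
factor through each other in one direction. -/
theorem IsProjectiveCover.exists_eq_mul_or [IsSimpleModule A S] (h : IsProjectiveCover π)
    (hA : IsSerialRing Aᵐᵒᵖ) {x : P} {s : P →ₗ[A] A} (hx : π x ≠ 0) (hs : ∀ p, s p • x = p)
    {a b : A} (ha : s x * a = a) (hb : s x * b = b) :
    (∃ r, a = b * r) ∨ ∃ r, b = a * r := by
  have he : s x * s x = s x := by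
    nth_rewrite 3 [← hs x]
    rw [map_smul, smul_eq_mul]
  have hu := isUniserial_span_op hA he (h.isIndecomposable_span_op hx hs)
  have hgen : ∀ (a b : A) (ha : op a ∈ Submodule.span Aᵐᵒᵖ {op (s x)})
      (hb : op b ∈ Submodule.span Aᵐᵒᵖ {op (s x)}),
      Submodule.span Aᵐᵒᵖ {(⟨op a, ha⟩ : Submodule.span Aᵐᵒᵖ {op (s x)})} ≤
        Submodule.span Aᵐᵒᵖ {(⟨op b, hb⟩ : Submodule.span Aᵐᵒᵖ {op (s x)})} →
      ∃ r, a = b * r := by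
    intro a b ha hb hle
    obtain ⟨r, hr⟩ := Submodule.mem_span_singleton.1
      (hle (Submodule.mem_span_singleton_self _))
    exact ⟨unop r, (congrArg (fun z : Submodule.span Aᵐᵒᵖ {op (s x)} => unop (z : Aᵐᵒᵖ)) hr).symm⟩
  have ha' := (mem_span_op_iff he (op a)).2 ha
  have hb' := (mem_span_op_iff he (op b)).2 hb
  rcases hu (Submodule.span Aᵐᵒᵖ {⟨op a, ha'⟩}) (Submodule.span Aᵐᵒᵖ {⟨op b, hb'⟩}) with h1 | h1
  · exact Or.inl (hgen a b ha' hb' h1)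
  · exact Or.inr (hgen b a hb' ha' h1)

end Right

end Cover

/-! ### The quiver of a Nakayama ring -/

section Quiver

variable {A : Type u} [Ring A] {n : ℕ} {S P : Fin n → Type u}
  [∀ i, AddCommGroup (S i)] [∀ i, Module A (S i)] [∀ i, AddCommGroup (P i)] [∀ i, Module A (P i)]

/-- `S b` is a quotient of the radical of the projective cover `P a` of `S a`. -/
def IsSuccessor (π : ∀ i, P i →ₗ[A] S i) (a b : Fin n) : Prop :=
  ∃ f : LinearMap.ker (π a) →ₗ[A] S b, Function.Surjective f

variable {π : ∀ i, P i →ₗ[A] S i} (hS : IsCompleteFamilyOfSimples A S)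
  (hπ : ∀ i, IsProjectiveCover (π i))

include hS

include hπ in
theorem eq_of_ne_zero {i j : Fin n} {f : P i →ₗ[A] S j} (hf : f ≠ 0) : j = i := by
  have := hS.simple
  exact hS.pairwise _ _ ((hπ i).nonempty_equiv_of_ne_zero hf)

include hπ in
theorem eq_of_surjective {i j : Fin n} {f : P i →ₗ[A] P j} (hf : Function.Surjective f) :
    j = i := by
  have := hS.simple
  refine eq_of_ne_zero hS hπ (f := π j ∘ₗ f) fun h0 => ?_
  obtain ⟨y, hy⟩ := (hπ j).exists_ne_zero
  obtain ⟨x, rfl⟩ := hf y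
  exact hy (LinearMap.congr_fun h0 x)

/-- Every nonzero finitely generated module has a simple quotient, hence receives a nonzero map
from some `P i` that stays nonzero in `S i`. -/
theorem exists_surjective_to_simple {M : Type u} [AddCommGroup M] [Module A M] [Module.Finite A M]
    [Nontrivial M] : ∃ (i : Fin n) (q : M →ₗ[A] S i), Function.Surjective q := by
  obtain ⟨K, hK⟩ := IsCoatomic.exists_coatom (Submodule A M)
  have : IsSimpleModule A (M ⧸ K) := isSimpleModule_iff_isCoatom.2 hK
  obtain ⟨i, ⟨e⟩⟩ := hS.complete (M ⧸ K) this
  exact ⟨i, e.toLinearMap ∘ₗ K.mkQ, e.surjective.comp K.mkQ_surjective⟩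

theorem ker_ne_bot_of_isSuccessor {a b : Fin n} (h : IsSuccessor π a b) :
    LinearMap.ker (π a) ≠ ⊥ := by
  have := hS.simple
  intro h0
  obtain ⟨f, hf⟩ := h
  have := IsSimpleModule.nontrivial A (S b)
  obtain ⟨y, hy⟩ := exists_ne (0 : S b)
  obtain ⟨⟨x, hx⟩, rfl⟩ := hf y
  rw [h0, Submodule.mem_bot] at hx
  subst hx
  exact hy (map_zero f)

include hπ

theorem exists_isSuccessor [IsNoetherianRing A] {a : Fin n} (h : LinearMap.ker (π a) ≠ ⊥) :
    ∃ b, IsSuccessor π a b := by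
  have := hS.simple
  have := (hπ a).finite
  have := Submodule.nontrivial_iff_ne_bot.2 h
  exact exists_surjective_to_simple hS

/-- The radical is uniserial, so it has at most one maximal submodule. -/
theorem isSuccessor_unique (hA : IsSerialRing A) {a b b' : Fin n} (h : IsSuccessor π a b)
    (h' : IsSuccessor π a b') : b = b' := by
  have := hS.simple
  obtain ⟨f, hf⟩ := h
  obtain ⟨f', hf'⟩ := h'
  have hu := ((hπ a).isUniserial hA).submodule (LinearMap.ker (π a))
  have h1 := LinearMap.isCoatom_ker_of_surjective hf
  have h2 := LinearMap.isCoatom_ker_of_surjective hf'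
  have hker : LinearMap.ker f = LinearMap.ker f' :=
    ((h1.le_iff_eq h2.1).1 (h2.le_of_isUniserial hu h1.1)).symm
  exact hS.pairwise _ _ ⟨(f.quotKerEquivOfSurjective hf).symm ≪≫ₗ
    Submodule.quotEquivOfEq _ _ hker ≪≫ₗ f'.quotKerEquivOfSurjective hf'⟩

/-- If `S b` is a quotient of the radical of `P a`, then `P b` is a projective cover of that
radical. -/
theorem exists_surjective_of_isSuccessor (hA : IsSerialRing A) {a b : Fin n}
    (h : IsSuccessor π a b) :
    ∃ g : P b →ₗ[A] LinearMap.ker (π a), Function.Surjective g := by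
  have := hS.simple
  obtain ⟨f, hf⟩ := h
  have := (hπ b).projective
  obtain ⟨g, hg⟩ := Module.projective_lifting_property f (π b) hf
  have hu := ((hπ a).isUniserial hA).submodule (LinearMap.ker (π a))
  refine ⟨g, LinearMap.range_eq_top.1 ?_⟩
  by_contra hne
  have hle := (LinearMap.isCoatom_ker_of_surjective hf).le_of_isUniserial hu hne
  obtain ⟨x, hx⟩ := (hπ b).exists_ne_zero
  exact hx ((LinearMap.congr_fun hg x).symm.trans (hle ⟨x, rfl⟩))

/-- The two maps from `P b` onto the radicals correspond to elements of one uniserial right ideal,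
so one of them, say `g'`, factors as `h ∘ g` with `h : P a → P a'`. If `a ≠ a'`, then `h` is not
surjective and lands in rad `P a'`, which is already the image of rad `P a`. Hence `P a = ker h +
rad P a`, so `h = 0` by superfluity. This makes rad `P a'` zero, a contradiction. -/
theorem isSuccessor_injective (hA : IsNakayama A) {a a' b : Fin n} (h : IsSuccessor π a b)
    (h' : IsSuccessor π a' b) : a = a' := by
  have := hS.simple
  obtain ⟨x, s, hx, hs⟩ := (hπ b).exists_generator
  have key : ∀ {a a' : Fin n} (g : P b →ₗ[A] LinearMap.ker (π a))
      (g' : P b →ₗ[A] LinearMap.ker (π a')), Function.Surjective g → Function.Surjective g' →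
      ∀ (h : P a →ₗ[A] P a'), LinearMap.ker (π a') ≠ ⊥ →
      (h (g x : P a) = g' x) → a = a' := by
    intro a a' g g' hg hg' h h0 hx
    by_contra hne
    have hgen : ∀ p, h (g p : P a) = g' p := by
      intro p
      rw [← hs p, map_smul, map_smul, Submodule.coe_smul, Submodule.coe_smul, map_smul, hx]
    have hrange : LinearMap.range h ≤ LinearMap.ker (π a') := by
      refine (hπ a').le_ker fun htop => hne ?_
      exact (eq_of_surjective hS hπ (LinearMap.range_eq_top.1 htop)).symm
    have htop : LinearMap.ker h ⊔ LinearMap.ker (π a) = ⊤ := by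
      rw [eq_top_iff]
      intro p _
      obtain ⟨q, hq⟩ := hg' ⟨h p, hrange ⟨p, rfl⟩⟩
      have : h p = h (g q : P a) := by rw [hgen, hq]
      refine Submodule.mem_sup.2 ⟨p - g q, ?_, g q, (g q).2, by abel⟩
      rw [LinearMap.mem_ker, map_sub, this, sub_self]
    have hker := (hπ a).superfluous _ htop
    apply h0
    rw [Submodule.eq_bot_iff]
    intro y hy
    obtain ⟨q, hq⟩ := hg' ⟨y, hy⟩
    have h1 := hgen q
    rw [hq, LinearMap.ker_eq_top.1 hker] at h1
    exact h1.symm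
  obtain ⟨g, hg⟩ := exists_surjective_of_isSuccessor hS hπ hA.left h
  obtain ⟨g', hg'⟩ := exists_surjective_of_isSuccessor hS hπ hA.left h'
  obtain ⟨y, t, -, ht⟩ := (hπ a).exists_generator
  obtain ⟨y', t', -, ht'⟩ := (hπ a').exists_generator
  have hmul : ∀ {a : Fin n} (g : P b →ₗ[A] LinearMap.ker (π a)) (t : P a →ₗ[A] A),
      s x * t (g x : P a) = t (g x : P a) := by
    intro a g t
    nth_rewrite 3 [← hs x]
    rw [map_smul, Submodule.coe_smul, map_smul, smul_eq_mul]
  rcases (hπ b).exists_eq_mul_or hA.right hx hs (hmul g t) (hmul g' t') with ⟨r, hr⟩ | ⟨r, hr⟩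
  · refine (key g' g hg' hg (LinearMap.toSpanSingleton A _ (r • y) ∘ₗ t')
      (ker_ne_bot_of_isSuccessor hS h) ?_).symm
    simp only [LinearMap.comp_apply, LinearMap.toSpanSingleton_apply]
    rw [smul_smul, ← hr, ht]
  · refine key g g' hg hg' (LinearMap.toSpanSingleton A _ (r • y') ∘ₗ t)
      (ker_ne_bot_of_isSuccessor hS h') ?_
    simp only [LinearMap.comp_apply, LinearMap.toSpanSingleton_apply]
    rw [smul_smul, ← hr, ht']

/-- A surjection from rad `P a` to `S b` would extend to `P a`. The extension is a nonzero map to a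
simple module, so it kills the unique maximal submodule rad `P a`. -/
theorem not_isSuccessor_of_injective {b : Fin n} (hb : Module.Injective A (S b)) (a : Fin n) :
    ¬ IsSuccessor π a b := by
  have := hS.simple
  rintro ⟨f, hf⟩
  have := IsSimpleModule.nontrivial A (S b)
  obtain ⟨h, hh⟩ := hb.out (LinearMap.ker (π a)).subtype (Submodule.injective_subtype _) f
  obtain ⟨y, hy⟩ := exists_ne (0 : S b)
  obtain ⟨x, rfl⟩ := hf y
  have hne : h ≠ 0 := fun h0 => hy (by rw [← hh x, h0]; rfl)
  have hker := LinearMap.isCoatom_ker_of_surjective (LinearMap.surjective_of_ne_zero hne)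
  have heq := (hker.le_iff_eq (hπ a).isCoatom_ker.1).1 ((hπ a).le_ker hker.1)
  have hx : (x : P a) ∈ LinearMap.ker h := heq ▸ x.2
  exact hy ((hh x).symm.trans hx)

/-- By Baer's criterion it suffices to enlarge a maximal partial extension `g'` on a left ideal `I'
≠ ⊤`. Choose `I''` covering `I'` with quotient `S a`, and present `I''` as a quotient of `I' × P a`.
The map `g'` on `I'` and `0` on `P a` descends to `I''`, because the induced map rad `P a → I' → S
b` vanishes by hypothesis. -/
theorem injective_of_forall_not_isSuccessor [IsArtinianRing A] {b : Fin n}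
    (hb : ∀ a, ¬ IsSuccessor π a b) : Module.Injective A (S b) := by
  have := hS.simple
  refine Module.Baer.injective fun I g => ?_
  let X : Set (Submodule A A) :=
    {I' | ∃ h : I ≤ I', ∃ g' : I' →ₗ[A] S b, g' ∘ₗ Submodule.inclusion h = g}
  have hX : X.Nonempty := ⟨I, le_rfl, g, by ext; rfl⟩
  obtain ⟨I', ⟨hle, g', hg'⟩, hmax⟩ := WellFounded.has_min
    (r := fun x y : Submodule A A => y < x) wellFounded_gt X hX
  by_cases htop : I' = ⊤
  · subst htop
    refine ⟨g' ∘ₗ (Submodule.topEquiv (R := A) (M := A)).symm.toLinearMap, fun x mx => ?_⟩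
    rw [← hg']
    rfl
  exfalso
  obtain ⟨I'', hcov⟩ := exists_covBy_of_wellFoundedLT (a := I') (by simpa using htop)
  have hsimple := (covBy_iff_quot_is_simple hcov.le).1 hcov
  obtain ⟨a, ⟨e⟩⟩ := hS.complete _ hsimple
  set N := I'.comap I''.subtype with hN
  have := (hπ a).projective
  obtain ⟨l, hl⟩ := Module.projective_lifting_property N.mkQ (e.symm.toLinearMap ∘ₗ π a)
    N.mkQ_surjective
  have hlN : ∀ p, l p ∈ N ↔ p ∈ LinearMap.ker (π a) := by
    intro p
    rw [← Submodule.Quotient.mk_eq_zero, ← Submodule.mkQ_apply, ← LinearMap.comp_apply, hl]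
    simp
  let r : LinearMap.ker (π a) →ₗ[A] I' :=
    LinearMap.codRestrict I' (I''.subtype ∘ₗ l ∘ₗ (LinearMap.ker (π a)).subtype)
      fun p => (hlN p).2 p.2
  have hr : g' ∘ₗ r = 0 := by
    by_contra hne
    exact hb a ⟨_, LinearMap.surjective_of_ne_zero hne⟩
  let Φ : (I' × P a) →ₗ[A] I'' := LinearMap.coprod (Submodule.inclusion hcov.le) l
  have hΦ : Function.Surjective Φ := by
    intro z
    obtain ⟨p, hp⟩ := (hπ a).surjective (e (N.mkQ z))
    have hz : z - l p ∈ N := by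
      rw [← Submodule.Quotient.mk_eq_zero, ← Submodule.mkQ_apply, map_sub, ← LinearMap.comp_apply,
        hl]
      simp [hp]
    refine ⟨(⟨z - l p, hz⟩, p), ?_⟩
    apply Subtype.ext
    simp [Φ]
  have hker : LinearMap.ker Φ ≤ LinearMap.ker (g' ∘ₗ LinearMap.fst A I' (P a)) := by
    rintro ⟨y, p⟩ hyp
    have h1 : (y : A) + l p = 0 := congrArg Subtype.val (show Φ (y, p) = 0 from hyp)
    have h2 : p ∈ LinearMap.ker (π a) := by
      rw [← hlN]
      change (l p : A) ∈ I'
      rw [← neg_eq_of_add_eq_zero_right h1]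
      exact I'.neg_mem y.2
    have h3 : y = -r ⟨p, h2⟩ := Subtype.ext (eq_neg_of_add_eq_zero_left h1)
    have h4 : g' (r ⟨p, h2⟩) = 0 := LinearMap.congr_fun hr _
    change g' y = 0
    rw [h3, map_neg, h4, neg_zero]
  let g'' : I'' →ₗ[A] S b := (LinearMap.ker Φ).liftQ _ hker ∘ₗ
    (Φ.quotKerEquivOfSurjective hΦ).symm.toLinearMap
  have hg'' : ∀ y, g'' (Φ y) = g' y.1 := by
    intro y
    have : (Φ.quotKerEquivOfSurjective hΦ).symm (Φ y) = Submodule.Quotient.mk y := by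
      rw [LinearEquiv.symm_apply_eq]
      rfl
    simp [g'', this]
  refine hmax I'' ⟨hle.trans hcov.le, g'', ?_⟩ hcov.lt
  ext y
  have := hg'' (Submodule.inclusion hle y, 0)
  rw [← hg']
  simp only [Φ, LinearMap.coprod_apply, map_zero, add_zero] at this
  exact this

end Quiver

/-! ### Composition series of the indecomposable projective modules -/

section CompositionFactors

variable {A : Type u} [Ring A] {n : ℕ} {S P : Fin n → Type u}
  [∀ i, AddCommGroup (S i)] [∀ i, Module A (S i)] [∀ i, AddCommGroup (P i)] [∀ i, Module A (P i)]
  {π : ∀ i, P i →ₗ[A] S i} (hS : IsCompleteFamilyOfSimples A S)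
  (hπ : ∀ i, IsProjectiveCover (π i))

/-- The image of the radical under a map out of the projective cover of a simple module is the
unique submodule that is covered by the image. -/
theorem eq_map_ker_of_covBy [∀ i, IsSimpleModule A (S i)] (hπ : ∀ i, IsProjectiveCover (π i))
    {M : Type u} [AddCommGroup M] [Module A M] {i : Fin n}
    (g : P i →ₗ[A] M) {N : Submodule A M} (hN : N ⋖ LinearMap.range g) :
    N = (LinearMap.ker (π i)).map g ∧ N.comap g = LinearMap.ker (π i) := by
  have hne : N.comap g ≠ ⊤ := by
    intro h
    refine hN.lt.not_ge ?_
    rintro _ ⟨x, rfl⟩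
    have : x ∈ N.comap g := h ▸ Submodule.mem_top
    exact this
  have hle := (hπ i).le_ker hne
  have hN' : (N.comap g).map g = N := by
    rw [Submodule.map_comap_eq]
    exact inf_eq_right.2 hN.le
  have h1 : N ≤ (LinearMap.ker (π i)).map g := by
    nth_rewrite 1 [← hN']
    exact Submodule.map_mono hle
  have hcomap : ((LinearMap.ker (π i)).map g).comap g = LinearMap.ker (π i) := by
    rw [Submodule.comap_map_eq]
    refine sup_eq_left.2 ((LinearMap.ker_le_comap g).trans hle)
  have h2 : (LinearMap.ker (π i)).map g ≠ LinearMap.range g := by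
    intro h
    apply (hπ i).isCoatom_ker.1
    rw [← hcomap, h, eq_top_iff]
    exact fun x _ => ⟨x, rfl⟩
  have h3 : N = (LinearMap.ker (π i)).map g := by
    rcases hN.eq_or_eq h1 (LinearMap.map_le_range (f := g)) with h | h
    · exact h.symm
    · exact absurd h h2
  exact ⟨h3, by rw [h3, hcomap]⟩

theorem nonempty_factor_equiv [∀ i, IsSimpleModule A (S i)] (hπ : ∀ i, IsProjectiveCover (π i))
    {M : Type u} [AddCommGroup M] [Module A M] {i : Fin n}
    (g : P i →ₗ[A] M) {N N' : Submodule A M} (hN : N ⋖ N') (hg : LinearMap.range g = N') :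
    Nonempty ((N' ⧸ N.comap N'.subtype) ≃ₗ[A] S i) := by
  subst hg
  have := (covBy_iff_quot_is_simple hN.le).1 hN
  refine (hπ i).nonempty_equiv_of_ne_zero
    (f := (N.comap (LinearMap.range g).subtype).mkQ ∘ₗ g.rangeRestrict) fun h => ?_
  obtain ⟨x, hx⟩ := (hπ i).exists_ne_zero
  have h1 : g x ∈ N := by
    have := LinearMap.congr_fun h x
    simpa using this
  have h2 : x ∈ N.comap g := h1
  rw [(eq_map_ker_of_covBy hπ g hN).2] at h2
  exact hx h2

variable {σ : Equiv.Perm (Fin n)} (hσ : ∀ a, LinearMap.ker (π a) ≠ ⊥ → IsSuccessor π a (σ a))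

include hS hπ hσ

/-- Walk down the series. Below the image of `P i` under `g`, the next term must be `g (rad P i)`,
and rad `P i` is an image of `P (σ i)`. -/
theorem exists_range_eq_compositionSeries (hA : IsSerialRing A) {j : Fin n}
    (s : CompositionSeries (Submodule A (P j))) (h₀ : s.head = ⊥) (h₁ : s.last = ⊤) (t : ℕ)
    (ht : t < s.length) :
    ∃ g : P ((σ ^ t) j) →ₗ[A] P j, LinearMap.range g = s ⟨s.length - t, by omega⟩ := by
  have := hS.simple
  induction t with
  | zero =>
    change ∃ g : P j →ₗ[A] P j, LinearMap.range g = _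
    refine ⟨LinearMap.id, ?_⟩
    rw [LinearMap.range_id, ← h₁]
    rfl
  | succ t ih =>
    obtain ⟨g, hg⟩ := ih (by omega)
    have hcov : s ⟨s.length - (t + 1), by omega⟩ ⋖ LinearMap.range g := by
      rw [hg]
      have h := s.step ⟨s.length - (t + 1), by omega⟩
      have h2 : (⟨s.length - t, by omega⟩ : Fin (s.length + 1)) =
          (⟨s.length - (t + 1), by omega⟩ : Fin s.length).succ := by
        ext
        simp only [Fin.val_succ]
        omega
      rw [h2]
      exact h
    have hmap := (eq_map_ker_of_covBy hπ g hcov).1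
    -- A zero radical would make this term the bottom one, but `t + 1 < s.length` keeps its index
    -- positive.
    have hne : LinearMap.ker (π ((σ ^ t) j)) ≠ ⊥ := by
      intro h
      rw [h, Submodule.map_bot, ← h₀] at hmap
      have := s.injective hmap
      have := congrArg Fin.val this
      simp at this
      omega
    obtain ⟨f, hf⟩ := exists_surjective_of_isSuccessor hS hπ hA (hσ _ hne)
    have hpow : (σ ^ (t + 1)) j = σ ((σ ^ t) j) := by rw [pow_succ', Equiv.Perm.mul_apply]
    rw [hpow]
    refine ⟨g ∘ₗ (LinearMap.ker (π ((σ ^ t) j))).subtype ∘ₗ f, ?_⟩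
    rw [hmap, LinearMap.range_comp, LinearMap.range_comp, LinearMap.range_eq_top.2 hf,
      Submodule.map_top, Submodule.range_subtype]

theorem nonempty_factor_equiv_pow (hA : IsSerialRing A) {j : Fin n}
    (s : CompositionSeries (Submodule A (P j))) (h₀ : s.head = ⊥) (h₁ : s.last = ⊤)
    (i : Fin s.length) :
    Nonempty ((s i.succ ⧸ (s i.castSucc).comap (s i.succ).subtype) ≃ₗ[A]
      S ((σ ^ (s.length - 1 - i : ℕ)) j)) := by
  have := hS.simple
  obtain ⟨g, hg⟩ := exists_range_eq_compositionSeries hS hπ hσ hA s h₀ h₁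
    (s.length - 1 - i) (by omega)
  refine nonempty_factor_equiv hπ g (s.step i) (hg.trans ?_)
  congr 1
  ext
  simp only [Fin.val_succ]
  omega

omit hS hπ hσ in
theorem exists_compositionSeries [IsArtinianRing A] (M : Type u) [AddCommGroup M] [Module A M]
    [Module.Finite A M] :
    ∃ s : CompositionSeries (Submodule A M), s.head = ⊥ ∧ s.last = ⊤ ∧
      s.length = (Module.length A M).toNat := by
  obtain ⟨s, h₀, h₁⟩ := exists_compositionSeries_of_isNoetherian_isArtinian A M
  exact ⟨s, h₀, h₁, by rw [← Module.length_compositionSeries s h₀ h₁, ENat.toNat_natCast]⟩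

theorem cartanMatrix_eq_kupischMatrix [IsArtinianRing A] (hA : IsSerialRing A) :
    cartanMatrix A S P = kupischMatrix σ fun i => (Module.length A (P i)).toNat := by
  have := hS.simple
  ext i j
  have := (hπ j).finite
  obtain ⟨s, h₀, h₁, hlen⟩ := exists_compositionSeries (A := A) (P j)
  rw [cartanMatrix, Matrix.of_apply, multiplicity_eq_factorCount _ s h₀ h₁, factorCount,
    kupischMatrix, Matrix.of_apply, ← hlen, ← Fintype.card_coe, ← Nat.card_eq_fintype_card]
  refine Nat.card_congr ?_
  have hiff : ∀ m : Fin s.length,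
      Nonempty ((s m.succ ⧸ (s m.castSucc).comap (s m.succ).subtype) ≃ₗ[A] S i) ↔
        (σ ^ (s.length - 1 - m : ℕ)) j = i := by
    intro m
    obtain ⟨e⟩ := nonempty_factor_equiv_pow hS hπ hσ hA s h₀ h₁ m
    constructor
    · rintro ⟨e'⟩
      exact hS.pairwise _ _ ⟨e.symm ≪≫ₗ e'⟩
    · rintro rfl
      exact ⟨e⟩
  -- Series indices count from the socle and exponents of `σ` from the top, whence the reflection `m
  -- ↦ s.length - 1 - m`.
  exact
    { toFun := fun m => ⟨s.length - 1 - m.1, by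
        have := m.1.2
        exact Finset.mem_filter.2 ⟨Finset.mem_range.2 (by omega), (hiff m.1).1 m.2⟩⟩
      invFun := fun t => ⟨⟨s.length - 1 - t.1, by
        have := Finset.mem_range.1 (Finset.mem_filter.1 t.2).1
        omega⟩, (hiff _).2 (by
          have := Finset.mem_range.1 (Finset.mem_filter.1 t.2).1
          have h2 : s.length - 1 - (s.length - 1 - t.1) = t.1 := by omega
          simp only [h2]
          exact (Finset.mem_filter.1 t.2).2)⟩
      left_inv := fun m => by
        ext
        have := m.1.2
        simp only
        omega
      right_inv := fun t => by
        ext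
        have := Finset.mem_range.1 (Finset.mem_filter.1 t.2).1
        simp only
        omega }

omit hσ in
theorem one_le_length [IsArtinianRing A] (i : Fin n) :
    1 ≤ (Module.length A (P i)).toNat := by
  have := hS.simple
  have := (hπ i).finite
  have := (hπ i).nontrivial
  have h := Module.length_pos (R := A) (M := P i)
  have h2 := Module.length_ne_top (R := A) (M := P i)
  rw [Nat.one_le_iff_ne_zero]
  intro h0
  rcases (ENat.toNat_eq_zero).1 h0 with h3 | h3
  · exact h.ne' h3
  · exact h2 h3

/-- The bottom nonzero term of a composition series is simple, and a uniserial module has at most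
one simple submodule. -/
theorem nonempty_socle_equiv [IsArtinianRing A] (hA : IsSerialRing A) (j : Fin n) :
    Nonempty (socle A (P j) ≃ₗ[A] S ((σ ^ ((Module.length A (P j)).toNat - 1)) j)) := by
  have := hS.simple
  have := (hπ j).finite
  have hpos := one_le_length hS hπ j
  obtain ⟨s, h₀, h₁, hlen⟩ := exists_compositionSeries (A := A) (P j)
  obtain ⟨e⟩ := nonempty_factor_equiv_pow hS hπ hσ hA s h₀ h₁ ⟨0, by omega⟩
  have hstep := s.step ⟨0, by omega⟩
  have hbot : s (⟨0, by omega⟩ : Fin s.length).castSucc = ⊥ := h₀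
  set N := s (⟨0, by omega⟩ : Fin s.length).succ with hN
  rw [hbot] at e
  have hatom : IsAtom N := by
    rw [← bot_covBy_iff, ← hbot]
    exact hstep
  have hu := (hπ j).isUniserial hA
  have hsoc : socle A (P j) = N := by
    refine le_antisymm (sSup_le fun T hT => ?_) (le_sSup (isSimpleModule_iff_isAtom.2 hatom))
    have hT' : IsAtom T := isSimpleModule_iff_isAtom.1 hT
    rcases hu T N with h | h
    · exact h
    · exact ((hT'.le_iff_eq hatom.1).1 h).symm.le
  rw [hsoc, ← hlen]
  have hcomap : (⊥ : Submodule A (P j)).comap N.subtype = ⊥ := by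
    rw [Submodule.comap_bot, Submodule.ker_subtype]
  exact ⟨(Submodule.quotEquivOfEqBot _ hcomap).symm ≪≫ₗ e⟩

/-! ### Homomorphisms between indecomposable projective modules -/

/-- If no factor of `P i` were `S j`, the image of `f` would map to zero in every factor and sink
through the whole series to `⊥`. -/
theorem exists_pow_eq_of_ne_zero [IsArtinianRing A] (hA : IsSerialRing A) {i j : Fin n}
    {f : P j →ₗ[A] P i} (hf : f ≠ 0) : ∃ t : ℕ, j = (σ ^ t) i := by
  have := hS.simple
  have := (hπ i).finite
  obtain ⟨s, h₀, h₁, hlen⟩ := exists_compositionSeries (A := A) (P i)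
  by_contra! hne
  have key : ∀ m : ℕ, ∀ hm : m ≤ s.length, LinearMap.range f ≤ s ⟨s.length - m, by omega⟩ := by
    intro m
    induction m with
    | zero =>
      intro _
      refine le_top.trans (h₁.symm.le.trans ?_)
      exact le_of_eq rfl
    | succ m ih =>
      intro hm
      have hle := ih (by omega)
      obtain ⟨e⟩ := nonempty_factor_equiv_pow hS hπ hσ hA s h₀ h₁ ⟨s.length - (m + 1), by omega⟩
      have hsucc : (⟨s.length - (m + 1), by omega⟩ : Fin s.length).succ =
          ⟨s.length - m, by omega⟩ := by
        ext
        simp only [Fin.val_succ]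
        omega
      rw [← hsucc] at hle
      set N := s (⟨s.length - (m + 1), by omega⟩ : Fin s.length).castSucc
      set N' := s (⟨s.length - (m + 1), by omega⟩ : Fin s.length).succ
      let f' : P j →ₗ[A] N' := f.codRestrict N' fun x => hle ⟨x, rfl⟩
      have hzero : e.toLinearMap ∘ₗ (N.comap N'.subtype).mkQ ∘ₗ f' = 0 := by
        by_contra h
        exact hne _ (eq_of_ne_zero hS hπ h).symm
      rintro _ ⟨x, rfl⟩
      have h1 : (N.comap N'.subtype).mkQ (f' x) = 0 := by
        apply e.injective
        rw [map_zero]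
        exact LinearMap.congr_fun hzero x
      rw [Submodule.mkQ_apply, Submodule.Quotient.mk_eq_zero] at h1
      exact h1
  have h := key s.length le_rfl
  have h2 : s ⟨s.length - s.length, by omega⟩ = ⊥ := by
    rw [← h₀]
    congr 1
    ext
    simp
  rw [h2, le_bot_iff, LinearMap.range_eq_bot] at h
  exact hf h

end CompositionFactors

/-! ### The cyclic order of the simple modules -/

section CyclicOrder

variable {A : Type u} [Ring A] {n : ℕ} {S P : Fin n → Type u}
  [∀ i, AddCommGroup (S i)] [∀ i, Module A (S i)] [∀ i, AddCommGroup (P i)] [∀ i, Module A (P i)]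
  {π : ∀ i, P i →ₗ[A] S i} (hS : IsCompleteFamilyOfSimples A S)
  (hπ : ∀ i, IsProjectiveCover (π i))

include hS hπ

omit hπ in
theorem pos_of_isCompleteFamilyOfSimples [Nontrivial A] : 0 < n := by
  obtain ⟨i, -⟩ := exists_surjective_to_simple hS (M := A)
  exact i.pos

/-- In a connected ring, a set of simple modules such that there are no homomorphisms from the
projective modules outside to those inside and conversely is trivial. -/
theorem eq_empty_or_eq_univ_of_hom_eq_zero (hconn : IsConnected A) {X : Set (Fin n)}
    (hX : ∀ i j, (i ∈ X ↔ j ∉ X) → ∀ f : P j →ₗ[A] P i, f = 0) : X = ∅ ∨ X = Set.univ := by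
  have := hS.simple
  have := hconn.nontrivial
  choose x s hx hs using fun i => (hπ i).exists_generator
  have hs0 : ∀ i, s i (x i) ≠ 0 := fun i h0 => hx i (by
    rw [← hs i (x i), h0, zero_smul, map_zero])
  have hs_mul : ∀ i p, s i p * s i (x i) = s i p := fun i p => by
    rw [← smul_eq_mul, ← map_smul, hs]
  -- With `e_j = s j (x j)`, this is the set of `a` with `e_j A a = 0` for all `j` outside `Y`: no
  -- composition factor of `A a` lies outside `Y`. It is a two-sided ideal.
  let I : Set (Fin n) → Submodule A A := fun Y =>
    { carrier := {a | ∀ j ∉ Y, ∀ b, s j (x j) * (b * a) = 0}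
      add_mem' := fun {a a'} ha ha' j hj b => by
        rw [mul_add, mul_add, ha j hj b, ha' j hj b, add_zero]
      zero_mem' := fun j _ b => by rw [mul_zero, mul_zero]
      smul_mem' := fun c a ha j hj b => by
        rw [smul_eq_mul, ← mul_assoc b]
        exact ha j hj _ }
  have hIr : ∀ Y a c, a ∈ I Y → a * c ∈ I Y := fun Y a c ha j hj b => by
    rw [← mul_assoc b, ← mul_assoc, ha j hj b, zero_mul]
  have hinf : ∀ a, a ∈ I X → a ∈ I Xᶜ → a = 0 := by
    intro a ha ha'
    by_contra hne
    have : Nontrivial (Submodule.span A {a}) :=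
      Submodule.nontrivial_iff_ne_bot.2 (by simpa using hne)
    obtain ⟨j, q, hq⟩ := exists_surjective_to_simple hS (M := Submodule.span A {a})
    have := (hπ j).projective
    obtain ⟨l, hl⟩ := Module.projective_lifting_property q (π j) hq
    obtain ⟨b, hb⟩ := Submodule.mem_span_singleton.1 (l (x j)).2
    have hzero : s j (x j) * (b * a) = 0 := by
      by_cases hj : j ∈ X
      · exact ha' j (fun h => h hj) b
      · exact ha j hj b
    have h1 : l (x j) = 0 := by
      rw [← hs j (x j), map_smul]
      apply Subtype.ext
      rw [Submodule.coe_smul, ← hb]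
      exact hzero
    apply hx j
    rw [← hl, LinearMap.comp_apply, h1, map_zero]
  have hgen : ∀ (Y : Set (Fin n)), (Y = X ∨ Y = Xᶜ) → ∀ i ∈ Y, ∀ f : P i →ₗ[A] A,
      f (x i) ∈ I Y := by
    intro Y hY i hi f j hj b
    have hij : i ∈ X ↔ j ∉ X := by
      rcases hY with rfl | rfl
      · simp [hi, hj]
      · simp only [Set.mem_compl_iff] at hi hj
        simp only [hi, false_iff]
        exact hj
    have h0 := hX i j hij (LinearMap.toSpanSingleton A _ (b • x i) ∘ₗ s j)
    have h1 : s j (x j) • b • x i = 0 := LinearMap.congr_fun h0 (x j)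
    have h2 := congrArg f h1
    rwa [map_smul, map_smul, map_zero] at h2
  -- Otherwise both ideals lie in a maximal left ideal `m` with `A ⧸ m` isomorphic to some `S i`. A
  -- lift `P i → A` of the cover sends the generator into one of the ideals by `hgen`, hence into
  -- `m`.
  have hsup : I X ⊔ I Xᶜ = ⊤ := by
    by_contra hne
    obtain ⟨m, hm, hle⟩ := (eq_top_or_exists_le_coatom (I X ⊔ I Xᶜ)).resolve_left hne
    have hmsimple : IsSimpleModule A (A ⧸ m) := isSimpleModule_iff_isCoatom.2 hm
    obtain ⟨i, ⟨e⟩⟩ := hS.complete _ hmsimple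
    have := (hπ i).projective
    obtain ⟨l, hl⟩ := Module.projective_lifting_property (e.toLinearMap ∘ₗ m.mkQ) (π i)
      (e.surjective.comp m.mkQ_surjective)
    have hlm : l (x i) ∈ m := by
      by_cases hi : i ∈ X
      · exact hle (Submodule.mem_sup_left (hgen X (Or.inl rfl) i hi l))
      · exact hle (Submodule.mem_sup_right (hgen Xᶜ (Or.inr rfl) i hi l))
    apply hx i
    have h1 : m.mkQ (l (x i)) = 0 := by simpa using hlm
    rw [← hl, LinearMap.comp_apply, LinearMap.comp_apply, h1, map_zero]
  -- The ideals are two-sided and complementary, so the component `a` of `1` is a central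
  -- idempotent.
  obtain ⟨a, ha, b, hb, hab⟩ := Submodule.mem_sup.1 (hsup ▸ Submodule.mem_top : (1 : A) ∈ _)
  have hcomm : ∀ c, c * a = a * c := by
    intro c
    rw [← sub_eq_zero]
    refine hinf _ ((I X).sub_mem ((I X).smul_mem c ha) (hIr X a c ha)) ?_
    have : c * a - a * c = b * c - c * b := by
      have h1 : c * (a + b) = (a + b) * c := by rw [hab, mul_one, one_mul]
      rw [mul_add, add_mul] at h1
      rw [sub_eq_sub_iff_add_eq_add, h1, add_comm]
    rw [this]
    exact (I Xᶜ).sub_mem (hIr Xᶜ b c hb) ((I Xᶜ).smul_mem c hb)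
  have hmul : a * b = 0 := hinf _ (hIr X a b ha) ((I Xᶜ).smul_mem a hb)
  have hidem : a * a = a := by
    have : a * (a + b) = a := by rw [hab, mul_one]
    rwa [mul_add, hmul, add_zero] at this
  rcases hconn.central_idempotent a hidem hcomm with h | h
  · left
    rw [h, zero_add] at hab
    rw [Set.eq_empty_iff_forall_notMem]
    intro j hj
    apply hs0 j
    have := hb j (fun h => h hj) 1
    rwa [hab, mul_one, mul_one] at this
  · right
    rw [Set.eq_univ_iff_forall]
    intro j
    by_contra hj
    apply hs0 j
    have := ha j hj 1
    rwa [h, mul_one, mul_one] at this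

/-- Nonzero maps between the `P i` stay inside a `σ`-orbit, so an orbit is a union of blocks of `A`.
-/
theorem sameCycle_of_isConnected [IsArtinianRing A] (hconn : IsConnected A)
    (hA : IsSerialRing A) {σ : Equiv.Perm (Fin n)}
    (hσ : ∀ a, LinearMap.ker (π a) ≠ ⊥ → IsSuccessor π a (σ a)) (a b : Fin n) :
    σ.SameCycle a b := by
  have h := eq_empty_or_eq_univ_of_hom_eq_zero hS hπ hconn (X := {i | σ.SameCycle a i}) ?_
  · rcases h with h | h
    · have : a ∈ (∅ : Set (Fin n)) := h ▸ Equiv.Perm.SameCycle.refl σ a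
      exact absurd this (Set.notMem_empty a)
    · have : b ∈ {i | σ.SameCycle a i} := h ▸ Set.mem_univ b
      exact this
  · intro i j hij f
    by_contra hf
    obtain ⟨t, rfl⟩ := exists_pow_eq_of_ne_zero hS hπ hσ hA hf
    simp at hij

/-- The successor map is a partial injection, defined where the radical is nonzero. It is extended
to a permutation arbitrarily; `apply_eq_of_ker_eq_bot` shows that connectedness fixes the remaining
value. -/
theorem exists_perm_isSuccessor [IsArtinianRing A] (hA : IsNakayama A) :
    ∃ σ : Equiv.Perm (Fin n), ∀ a, LinearMap.ker (π a) ≠ ⊥ → IsSuccessor π a (σ a) := by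
  classical
  choose f hf using fun a : {a // LinearMap.ker (π a) ≠ ⊥} => exists_isSuccessor hS hπ a.2
  let e : {a // LinearMap.ker (π a) ≠ ⊥} ≃ {b // b ∈ Set.range f} :=
    Equiv.ofInjective f fun a a' h => Subtype.ext
      (isSuccessor_injective hS hπ hA (hf a) (h ▸ hf a'))
  refine ⟨e.extendSubtype, fun a ha => ?_⟩
  rw [e.extendSubtype_apply_of_mem a ha]
  exact hf ⟨a, ha⟩

omit hS hπ in
-- Used to compare two transitive permutations that would differ by a transposition.
theorem sign_eq_of_sameCycle {σ : Equiv.Perm (Fin n)} (hn : 2 ≤ n)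
    (h : ∀ a b, σ.SameCycle a b) : Equiv.Perm.sign σ = -(-1) ^ n := by
  have := Fin.nontrivial_iff_two_le.2 hn
  obtain ⟨z⟩ : Nonempty (Fin n) := inferInstance
  have hfix : ∀ x, σ x ≠ x := by
    intro x hx
    obtain ⟨y, hy⟩ := exists_ne x
    obtain ⟨m, hm⟩ := h x y
    exact hy (hm.symm.trans (Equiv.Perm.zpow_apply_eq_self_of_apply_eq_self hx m))
  have hc : σ.IsCycle := ⟨z, hfix z, fun y _ => h z y⟩
  have hsupp : σ.support = Finset.univ := by
    ext x
    simp [hfix x]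
  rw [hc.sign, hsupp, Finset.card_univ, Fintype.card_fin]

/-- The successor of a projective simple module in the cyclic order is any injective simple
module; in particular, both are unique. -/
theorem apply_eq_of_ker_eq_bot [IsArtinianRing A] (hconn : IsConnected A) (hA : IsNakayama A)
    {σ : Equiv.Perm (Fin n)} (hσ : ∀ a, LinearMap.ker (π a) ≠ ⊥ → IsSuccessor π a (σ a))
    {a b : Fin n} (ha : LinearMap.ker (π a) = ⊥) (hb : ∀ c, ¬ IsSuccessor π c b) : σ a = b := by
  by_contra hne
  -- Exchanging the values `σ a` and `b` spoils no successor, so `τ` is also an `n`-cycle. It would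
  -- then have the same sign as `σ` while differing from it by a transposition.
  let τ : Equiv.Perm (Fin n) := Equiv.swap (σ a) b * σ
  have hτ : ∀ c, LinearMap.ker (π c) ≠ ⊥ → IsSuccessor π c (τ c) := by
    intro c hc
    have h1 : σ c ≠ σ a := fun h => hc (σ.injective h ▸ ha)
    have h2 : σ c ≠ b := fun h => hb c (h ▸ hσ c hc)
    have : τ c = σ c := by
      simp only [τ, Equiv.Perm.mul_apply]
      exact Equiv.swap_apply_of_ne_of_ne h1 h2
    rw [this]
    exact hσ c hc
  have hn : 2 ≤ n := Fin.nontrivial_iff_two_le.1 ⟨_, _, hne⟩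
  have h1 := sign_eq_of_sameCycle hn (sameCycle_of_isConnected hS hπ hconn hA.left hσ)
  have h2 := sign_eq_of_sameCycle hn (sameCycle_of_isConnected hS hπ hconn hA.left hτ)
  rw [← h1, Equiv.Perm.sign_mul, Equiv.Perm.sign_swap hne, neg_one_mul] at h2
  rcases Int.units_eq_one_or (Equiv.Perm.sign σ) with h | h <;> rw [h] at h2 <;>
    exact absurd h2 (by decide)

/-! ### Lengths and projective dimension -/

theorem length_ker_add_one [IsArtinianRing A] (i : Fin n) :
    (Module.length A (LinearMap.ker (π i))).toNat + 1 = (Module.length A (P i)).toNat := by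
  have := hS.simple
  have := (hπ i).finite
  have h := Module.length_eq_add_of_exact (LinearMap.ker (π i)).subtype (π i)
    (Submodule.injective_subtype _) (hπ i).surjective (LinearMap.exact_subtype_ker_map (π i))
  rw [h, Module.length_eq_one A (S i), ENat.toNat_add (Module.length_ne_top) ENat.one_ne_top]
  rfl

omit hS hπ in
theorem toNat_length_le_of_surjective [IsArtinianRing A] {M N : Type u} [AddCommGroup M]
    [Module A M] [AddCommGroup N] [Module A N] [Module.Finite A M] {g : M →ₗ[A] N}
    (hg : Function.Surjective g) :
    (Module.length A N).toNat ≤ (Module.length A M).toNat :=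
  ENat.toNat_le_toNat (Module.length_le_of_surjective g hg) Module.length_ne_top

variable {σ : Equiv.Perm (Fin n)} (hσ : ∀ a, LinearMap.ker (π a) ≠ ⊥ → IsSuccessor π a (σ a))

include hσ

theorem length_le_length_apply_add_one [IsArtinianRing A] (hA : IsSerialRing A) (i : Fin n) :
    (Module.length A (P i)).toNat ≤ (Module.length A (P (σ i))).toNat + 1 := by
  have := hS.simple
  have := (hπ i).finite
  have := (hπ (σ i)).finite
  rw [← length_ker_add_one hS hπ]
  by_cases h : LinearMap.ker (π i) = ⊥
  · rw [h, Module.length_bot]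
    simp
  · obtain ⟨g, hg⟩ := exists_surjective_of_isSuccessor hS hπ hA (hσ i h)
    exact Nat.succ_le_succ (toNat_length_le_of_surjective hg)

/-- The radical of `P i` is projective and nonzero if and only if the length drops by one. -/
theorem projective_ker_iff [IsArtinianRing A] (hA : IsSerialRing A) (i : Fin n) :
    (Module.Projective A (LinearMap.ker (π i)) ∧ LinearMap.ker (π i) ≠ ⊥) ↔
      (Module.length A (P i)).toNat = (Module.length A (P (σ i))).toNat + 1 := by
  have := hS.simple
  have := (hπ i).finite
  have := (hπ (σ i)).finite
  rw [← length_ker_add_one hS hπ]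
  constructor
  · rintro ⟨hp, h⟩
    obtain ⟨g, hg⟩ := exists_surjective_of_isSuccessor hS hπ hA (hσ i h)
    obtain ⟨t, ht⟩ := Module.projective_lifting_property g LinearMap.id hg
    have hinj : Function.Injective t := fun y z hyz => by
      rw [← LinearMap.id_apply (R := A) y, ← LinearMap.id_apply (R := A) z, ← ht,
        LinearMap.comp_apply, LinearMap.comp_apply, hyz]
    -- `P (σ i)` is the sum of `ker g` and the range of the section `t`. If that range were proper,
    -- both would lie in the unique maximal submodule.
    have htop : LinearMap.range t = ⊤ := by
      by_contra hne
      have hgk : LinearMap.ker g ≤ LinearMap.ker (π (σ i)) := by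
        refine (hπ (σ i)).le_ker fun hk => ?_
        have : Subsingleton (LinearMap.ker (π i)) := by
          refine ⟨fun y z => ?_⟩
          obtain ⟨y', rfl⟩ := hg y
          obtain ⟨z', rfl⟩ := hg z
          rw [LinearMap.ker_eq_top.1 hk]
          rfl
        exact h (Submodule.subsingleton_iff_eq_bot.1 this)
      apply (hπ (σ i)).isCoatom_ker.1
      rw [eq_top_iff]
      intro y _
      have h1 : y - t (g y) ∈ LinearMap.ker g := by
        have := LinearMap.congr_fun ht (g y)
        simp only [LinearMap.comp_apply, LinearMap.id_apply] at this
        rw [LinearMap.mem_ker, map_sub, this, sub_self]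
      have h2 := Submodule.add_mem _ (hgk h1) ((hπ (σ i)).le_ker hne ⟨g y, rfl⟩)
      rwa [sub_add_cancel] at h2
    rw [(LinearEquiv.ofBijective t ⟨hinj, LinearMap.range_eq_top.1 htop⟩).length_eq]
  · intro hlen
    have hne : LinearMap.ker (π i) ≠ ⊥ := by
      intro h
      rw [h, Module.length_bot] at hlen
      have := one_le_length hS hπ (σ i)
      simp only [ENat.toNat_zero] at hlen
      omega
    obtain ⟨g, hg⟩ := exists_surjective_of_isSuccessor hS hπ hA (hσ i hne)
    have hker : LinearMap.ker g = ⊥ := by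
      have h := Module.length_eq_add_of_exact (LinearMap.ker g).subtype g
        (Submodule.injective_subtype _) hg (LinearMap.exact_subtype_ker_map g)
      have h' := congrArg ENat.toNat h
      rw [ENat.toNat_add Module.length_ne_top Module.length_ne_top] at h'
      have h0 : (Module.length A (LinearMap.ker g)).toNat = 0 := by omega
      have h1 : Module.length A (LinearMap.ker g) = 0 :=
        (ENat.toNat_eq_zero.1 h0).resolve_right Module.length_ne_top
      exact Submodule.subsingleton_iff_eq_bot.1 (Module.length_eq_zero_iff.1 h1)
    have := (hπ (σ i)).projective
    exact ⟨Module.Projective.of_equiv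
      (LinearEquiv.ofBijective g ⟨LinearMap.ker_eq_bot.1 hker, hg⟩), hne⟩

open CategoryTheory in
-- The first syzygy of `S i` is rad `P i`, so projective dimension 1 means that this radical is
-- projective and nonzero.
theorem projectiveDimension_eq_one_iff [IsArtinianRing A] (hA : IsSerialRing A) (i : Fin n) :
    projectiveDimension (ModuleCat.of A (S i)) = 1 ↔
      (Module.length A (P i)).toNat = (Module.length A (P (σ i))).toNat + 1 := by
  have := hS.simple
  rw [← projective_ker_iff hS hπ hσ hA]
  have hproj : ∀ (M : Type u) [AddCommGroup M] [Module A M],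
      HasProjectiveDimensionLT (ModuleCat.of A M) 1 ↔ Module.Projective A M := by
    intro M _ _
    rw [← projective_iff_hasProjectiveDimensionLT_one]
    exact (IsProjective.iff_projective M).symm
  let X : ShortComplex (ModuleCat.{u} A) :=
    ShortComplex.mk (ModuleCat.ofHom (LinearMap.ker (π i)).subtype) (ModuleCat.ofHom (π i)) (by
      ext y
      exact y.2)
  have hX : X.ShortExact := by
    have hmono : Mono X.f := (ModuleCat.mono_iff_injective _).2 (Submodule.injective_subtype _)
    have hepi : Epi X.g := (ModuleCat.epi_iff_surjective _).2 (hπ i).surjective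
    refine ⟨?_⟩
    rw [ShortComplex.moduleCat_exact_iff]
    intro y hy
    exact ⟨⟨y, hy⟩, rfl⟩
  have hP : Projective X.X₂ := (IsProjective.iff_projective (P i)).1 (hπ i).projective
  have h2 := hX.hasProjectiveDimensionLT_X₃_iff 0 hP
  have h3 : HasProjectiveDimensionLT (ModuleCat.of A (S i)) 2 ↔
      Module.Projective A (LinearMap.ker (π i)) := h2.trans (hproj _)
  rw [ne_eq, ← (hπ i).projective_iff_ker_eq_bot, ← h3, ← hproj, ← projectiveDimension_ge_iff,
    ← projectiveDimension_lt_iff]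
  have h4 : projectiveDimension (ModuleCat.of A (S i)) < ((2 : ℕ) : WithBot ℕ∞) ↔
      projectiveDimension (ModuleCat.of A (S i)) ≤ ((1 : ℕ) : WithBot ℕ∞) := by
    rw [projectiveDimension_lt_iff, projectiveDimension_le_iff]
  rw [h4]
  exact le_antisymm_iff

end CyclicOrder

/-! ### Existence of injective envelopes -/

section InjectiveEnvelope

variable {R : Type u} [Ring R] {Q : Type u} [AddCommGroup Q] [Module R Q]

/-- The submodules containing `N` as an essential submodule. -/
def essentialExtensions (N : Submodule R Q) : Set (Submodule R Q) :=
  {E | N ≤ E ∧ ∀ L ≤ E, L ⊓ N = ⊥ → L = ⊥}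

/-- Zorn's lemma: essentiality passes to unions of chains because it can be tested on cyclic
submodules. -/
theorem exists_maximal_essentialExtensions (N : Submodule R Q) :
    ∃ E, Maximal (· ∈ essentialExtensions N) E := by
  suffices h : ∃ E, N ≤ E ∧ Maximal (· ∈ essentialExtensions N) E from h.imp fun _ => And.right
  refine zorn_le_nonempty₀ (essentialExtensions N) (fun c hc hchain E₀ hE₀ => ?_) N ?_
  · refine ⟨sSup c, ⟨(hc hE₀).1.trans (le_sSup hE₀), fun L hL h => ?_⟩, fun E hE => le_sSup hE⟩
    rw [Submodule.eq_bot_iff]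
    intro x hx
    obtain ⟨E, hE, hxE⟩ := (Submodule.mem_sSup_of_directed ⟨E₀, hE₀⟩ hchain.directedOn).1 (hL hx)
    have h1 := (hc hE).2 (Submodule.span R {x}) (by simpa using hxE) (by
      rw [eq_bot_iff, ← h]
      exact inf_le_inf_right _ (by simpa using hx))
    simpa using h1
  · exact ⟨le_rfl, fun L hL h => by rwa [inf_eq_left.2 hL] at h⟩

theorem exists_maximal_disjoint (E : Submodule R Q) :
    ∃ K, Maximal (fun K : Submodule R Q => K ⊓ E = ⊥) K := by
  suffices h : ∃ K, ⊥ ≤ K ∧ Maximal (fun K : Submodule R Q => K ⊓ E = ⊥) K from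
    h.imp fun _ => And.right
  refine zorn_le_nonempty₀ {K : Submodule R Q | K ⊓ E = ⊥}
    (fun c hc hchain K₀ hK₀ => ?_) ⊥ (bot_inf_eq E)
  · refine ⟨sSup c, ?_, fun K hK => le_sSup hK⟩
    change sSup c ⊓ E = ⊥
    rw [Submodule.eq_bot_iff]
    rintro x ⟨hx, hxE⟩
    obtain ⟨K, hK, hxK⟩ := (Submodule.mem_sSup_of_directed ⟨K₀, hK₀⟩ hchain.directedOn).1 hx
    have h1 : x ∈ K ⊓ E := ⟨hxK, hxE⟩
    rwa [show K ⊓ E = ⊥ from hc hK, Submodule.mem_bot] at h1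

/-- A maximal essential extension inside an injective module is injective. -/
theorem injective_of_maximal_essentialExtensions [Module.Injective R Q] {N E : Submodule R Q}
    (hE : Maximal (· ∈ essentialExtensions N) E) : Module.Injective R E := by
  obtain ⟨K, hK⟩ := exists_maximal_disjoint E
  have hKE : K ⊓ E = ⊥ := hK.prop
  have hinj : Function.Injective (K.mkQ ∘ₗ E.subtype) := by
    rw [← LinearMap.ker_eq_bot, LinearMap.ker_eq_bot']
    intro x hx
    have hxK : (x : Q) ∈ K := by simpa using hx
    have : (x : Q) ∈ K ⊓ E := ⟨hxK, x.2⟩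
    rw [hKE, Submodule.mem_bot] at this
    exact Subtype.ext this
  obtain ⟨ψ, hψ⟩ := Module.Injective.extension_property R Q _ _ _ hinj E.subtype
  -- `ρ` is the identity on `E` and kills a maximal complement `K`. Its range is again an essential
  -- extension of `N`, so by maximality it equals `E`, which is thus a retract of `Q`.
  set ρ : Q →ₗ[R] Q := ψ ∘ₗ K.mkQ with hρ
  have hρE : ∀ x ∈ E, ρ x = x := fun x hx => LinearMap.congr_fun hψ ⟨x, hx⟩
  have hρK : ∀ x ∈ K, ρ x = 0 := fun x hx => by
    rw [hρ, LinearMap.comp_apply, show K.mkQ x = 0 by simpa using hx, map_zero]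
  have hmax : ∀ L : Submodule R Q, K ≤ L → L ⊓ E = ⊥ → L = K := fun L hKL hL =>
    (hK.eq_of_le hL hKL).symm
  have hmem : LinearMap.range ρ ∈ essentialExtensions N := by
    refine ⟨fun x hx => ⟨x, hρE x (hE.prop.1 hx)⟩, fun L hL hLN => ?_⟩
    have hLE : L ⊓ E = ⊥ := hE.prop.2 _ inf_le_right (by
      rw [eq_bot_iff, ← hLN]
      exact inf_le_inf_right _ inf_le_left)
    -- The preimage contains `K` and still meets `E` trivially, so maximality of `K` applies.
    have h1 : L.comap ρ = K := by
      refine hmax _ (fun x hx => ?_) ?_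
      · change ρ x ∈ L
        rw [hρK x hx]
        exact L.zero_mem
      · rw [Submodule.eq_bot_iff]
        rintro x ⟨hx, hxE⟩
        have hx' : ρ x ∈ L := hx
        rw [hρE x hxE] at hx'
        have : x ∈ L ⊓ E := ⟨hx', hxE⟩
        rwa [hLE, Submodule.mem_bot] at this
    rw [Submodule.eq_bot_iff]
    intro y hy
    obtain ⟨x, rfl⟩ := hL hy
    exact hρK x (h1 ▸ hy)
  have hrange : LinearMap.range ρ = E :=
    (hE.eq_of_le hmem fun x hx => ⟨x, hρE x hx⟩).symm
  let r : Q →ₗ[R] E := ρ.codRestrict E fun x => hrange ▸ ⟨x, rfl⟩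
  refine ⟨fun X Y _ _ _ _ f hf g => ?_⟩
  obtain ⟨h, hh⟩ := Module.Injective.out f hf (E.subtype ∘ₗ g)
  refine ⟨r ∘ₗ h, fun x => Subtype.ext ?_⟩
  change ρ (h (f x)) = g x
  rw [hh]
  exact hρE _ (g x).2

theorem exists_isInjectiveEnvelope (M : Type u) [AddCommGroup M] [Module R M] :
    ∃ (E : Type u) (_ : AddCommGroup E) (_ : Module R E) (i : M →ₗ[R] E),
      IsInjectiveEnvelope i := by
  obtain ⟨⟨Q, hQ, f, hf⟩⟩ :=
    CategoryTheory.EnoughInjectives.presentation (ModuleCat.of R M)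
  have : Module.Injective R Q := Module.injective_module_of_injective_object R Q
  have hinj := (ModuleCat.mono_iff_injective f).1 hf
  obtain ⟨E, hE⟩ := exists_maximal_essentialExtensions (LinearMap.range f.hom)
  have hi : Function.Injective
      (f.hom.codRestrict E fun x => hE.prop.1 ⟨x, rfl⟩) := fun x y hxy =>
    hinj (congrArg Subtype.val hxy)
  refine ⟨E, inferInstance, inferInstance, f.hom.codRestrict E fun x => hE.prop.1 ⟨x, rfl⟩,
    injective_of_maximal_essentialExtensions hE, hi, fun N hN => ?_⟩
  have h1 := hE.prop.2 (N.map E.subtype) (Submodule.map_subtype_le _ _) (by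
    rw [Submodule.eq_bot_iff]
    rintro _ ⟨⟨y, hy, rfl⟩, x, hx⟩
    have : y ∈ N ⊓ LinearMap.range (f.hom.codRestrict E fun x => hE.prop.1 ⟨x, rfl⟩) :=
      ⟨hy, x, Subtype.ext hx⟩
    rw [hN, Submodule.mem_bot] at this
    rw [this]
    rfl)
  rw [Submodule.eq_bot_iff]
  intro y hy
  have h2 : (y : Q) ∈ N.map E.subtype := ⟨y, hy, rfl⟩
  rw [h1, Submodule.mem_bot] at h2
  exact Subtype.ext h2

end InjectiveEnvelope

/-! ### The transpose of a simple module -/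

section Transpose

variable {A : Type u} [Ring A] {P₁ P₀ M : Type u} [AddCommGroup P₁] [Module A P₁]
  [AddCommGroup P₀] [Module A P₀] [AddCommGroup M] [Module A M] {d : P₁ →ₗ[A] P₀}
  {p : P₀ →ₗ[A] M}

namespace IsMinimalPresentation

theorem range_eq_ker (h : IsMinimalPresentation d p) : LinearMap.range d = LinearMap.ker p := by
  refine le_antisymm ?_ fun y hy => ?_
  · rintro _ ⟨x, rfl⟩
    exact h.mem_ker x
  · obtain ⟨x, hx⟩ := h.cover_ker.surjective ⟨y, hy⟩
    exact ⟨x, congrArg Subtype.val hx⟩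

/-- In a minimal presentation of a simple module over a left Nakayama ring, the first term is a
projective cover of any simple quotient of the kernel. -/
theorem isProjectiveCover_comp [IsSimpleModule A M] (h : IsMinimalPresentation d p)
    (hA : IsSerialRing A) {S' : Type u} [AddCommGroup S'] [Module A S'] [IsSimpleModule A S']
    {q : LinearMap.ker p →ₗ[A] S'} (hq : Function.Surjective q) :
    IsProjectiveCover (q ∘ₗ d.codRestrict (LinearMap.ker p) h.mem_ker) where
  projective := h.cover_ker.projective
  surjective := hq.comp h.cover_ker.surjective
  superfluous N hN := by
    set d' := d.codRestrict (LinearMap.ker p) h.mem_ker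
    have hu := (h.cover.isUniserial hA).submodule (LinearMap.ker p)
    have hK := LinearMap.isCoatom_ker_of_surjective hq
    have htop : N.map d' = ⊤ := by
      by_contra hne
      have hle := hK.le_of_isUniserial hu hne
      have h1 : N ⊔ LinearMap.ker (q ∘ₗ d') ≤ LinearMap.ker (q ∘ₗ d') :=
        sup_le (fun x hx => hle ⟨x, hx, rfl⟩) le_rfl
      rw [hN] at h1
      apply hK.1
      rw [eq_top_iff]
      intro y _
      obtain ⟨x, rfl⟩ := h.cover_ker.surjective y
      exact h1 (Submodule.mem_top (x := x))
    refine h.cover_ker.superfluous N ?_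
    rw [eq_top_iff]
    intro x _
    obtain ⟨y, hy, hxy⟩ : d' x ∈ N.map d' := htop ▸ Submodule.mem_top
    exact Submodule.mem_sup.2 ⟨y, hy, x - y, by rw [LinearMap.mem_ker, map_sub, hxy, sub_self],
      by abel⟩

variable {S' : Type u} [AddCommGroup S'] [Module A S'] {π' : P₁ →ₗ[A] S'} {x₁ : P₁}
  {s₁ : P₁ →ₗ[A] A}

/-- This says that the class of `s₁` in the transpose is nonzero. Otherwise `d` would have a left
inverse `γ`, so `P₀ = ker γ + ker p`, which forces `γ = 0` by superfluity. -/
theorem section_ne_comp (h : IsMinimalPresentation d p) (hx₁ : π' x₁ ≠ 0)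
    (hs₁ : ∀ y, s₁ y • x₁ = y) (f : P₀ →ₗ[A] A) : f ∘ₗ d ≠ s₁ := by
  intro hf
  set γ : P₀ →ₗ[A] P₁ := LinearMap.toSpanSingleton A P₁ x₁ ∘ₗ f with hγ
  have hγd : ∀ y, γ (d y) = y := fun y => by
    have := LinearMap.congr_fun hf y
    simp only [LinearMap.comp_apply] at this
    rw [hγ, LinearMap.comp_apply, this, LinearMap.toSpanSingleton_apply, hs₁]
  have htop : LinearMap.ker γ ⊔ LinearMap.ker p = ⊤ := by
    rw [eq_top_iff]
    intro y _
    refine Submodule.mem_sup.2 ⟨y - d (γ y), ?_, d (γ y), h.mem_ker _, by abel⟩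
    rw [LinearMap.mem_ker, map_sub, hγd, sub_self]
  have h0 := LinearMap.ker_eq_top.1 (h.cover.superfluous _ htop)
  apply hx₁
  rw [← hγd x₁, h0, LinearMap.zero_apply, map_zero]

/-- A map from the projective cover of a simple module to the ring whose value on the generator is
not in the Jacobson radical is a split monomorphism. -/
theorem _root_.NakayamaAlgebra.IsProjectiveCover.exists_mul_eq_of_notMem_jacobson
    [IsNoetherianRing A] [IsSimpleModule A S']
    (h : IsProjectiveCover π') {g : P₁ →ₗ[A] A}
    (hg : g x₁ ∉ Ring.jacobson A) : ∃ t, s₁ x₁ = g x₁ * t := by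
  have := h.finite
  obtain ⟨m, hm, hgm⟩ : ∃ m : Submodule A A, IsCoatom m ∧ g x₁ ∉ m := by
    by_contra! hall
    exact hg (Submodule.mem_sInf.2 fun m hm => hall m hm)
  have hmsimple : IsSimpleModule A (A ⧸ m) := isSimpleModule_iff_isCoatom.2 hm
  have hqx : (m.mkQ ∘ₗ g) x₁ ≠ 0 := by simpa using hgm
  have hq : Function.Surjective (m.mkQ ∘ₗ g) :=
    LinearMap.surjective_of_ne_zero fun h0 => hqx (by rw [h0, LinearMap.zero_apply])
  obtain ⟨γ, hγ⟩ := Module.projective_lifting_property (m.mkQ ∘ₗ g) m.mkQ hq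
  have hker := LinearMap.isCoatom_ker_of_surjective hq
  have hker' := (hker.le_iff_eq h.isCoatom_ker.1).1 (h.le_ker hker.1)
  have hγx : (m.mkQ ∘ₗ g) (γ (g x₁)) ≠ 0 := by
    have := LinearMap.congr_fun hγ (g x₁)
    rw [LinearMap.comp_apply] at this
    rw [this]
    exact hqx
  have hsurj : Function.Surjective (γ ∘ₗ g) := by
    rw [← LinearMap.range_eq_top]
    refine h.eq_top_of_mem (x := γ (g x₁)) ⟨x₁, rfl⟩ fun h0 => hγx ?_
    have : γ (g x₁) ∈ LinearMap.ker π' := h0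
    rw [hker'] at this
    exact this
  have hinj : Function.Injective (γ ∘ₗ g) :=
    IsNoetherian.injective_of_surjective_endomorphism _ hsurj
  let e := LinearEquiv.ofBijective (γ ∘ₗ g) ⟨hinj, hsurj⟩
  have h1 : g x₁ • e.symm (γ 1) = x₁ := by
    rw [← map_smul, ← map_smul, smul_eq_mul, mul_one, LinearEquiv.symm_apply_eq]
    rfl
  refine ⟨s₁ (e.symm (γ 1)), ?_⟩
  nth_rewrite 1 [← h1]
  rw [map_smul, smul_eq_mul]

/-- This is the simplicity of the transpose: every nonzero class generates the class of `s₁`. If `g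
x₁` is outside the Jacobson radical, `g` splits. If it is inside, right uniseriality together with
Nakayama's lemma shows that `g x₁` is a right multiple of the element `a` representing `d`, so `g`
factors through `d`. -/
theorem exists_mul_eq [IsArtinianRing A] [IsSimpleModule A M] [IsSimpleModule A S']
    (h : IsMinimalPresentation d p)
    (hM : ¬ Module.Projective A M) (hA : IsSerialRing Aᵐᵒᵖ)
    (hπ' : IsProjectiveCover π') (hx₁ : π' x₁ ≠ 0) (hs₁ : ∀ y, s₁ y • x₁ = y) {g : P₁ →ₗ[A] A}
    (hg : ∀ f : P₀ →ₗ[A] A, f ∘ₗ d ≠ g) : ∃ t, s₁ x₁ = g x₁ * t := by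
  obtain ⟨x₀, s₀, hx₀, hs₀⟩ := h.cover.exists_generator
  have := h.cover.finite
  have hgx : ∀ (g : P₁ →ₗ[A] A) y, g y = s₁ y * g x₁ := fun g y => by
    rw [← smul_eq_mul, ← map_smul, hs₁]
  by_contra hno
  have hJ : g x₁ ∈ Ring.jacobson A := by
    by_contra hnJ
    exact hno (hπ'.exists_mul_eq_of_notMem_jacobson hnJ)
  set a := s₀ (d x₁) with ha_def
  have hea : s₁ x₁ * a = a := by
    rw [ha_def, ← smul_eq_mul, ← map_smul, ← map_smul, hs₁]
  have hax : a • x₀ = d x₁ := hs₀ _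
  -- Induction on the left ideal `A η`: a radical element `b = b * η` that is not a right multiple
  -- of `a` yields another one supported on a strictly smaller idempotent.
  have key : ∀ N : Submodule A A, ∀ η : A, Submodule.span A {η} = N → η * η = η →
      ∀ b ∈ Ring.jacobson A, s₁ x₁ * b = b → b * η = b → (∀ r, b ≠ a * r) → False := by
    intro N
    induction N using WellFoundedLT.induction with
    | ind N ih =>
    rintro η rfl hη b hbJ hb hbη hba
    obtain ⟨r₀, hr₀⟩ : ∃ r, a = b * r :=
      (hπ'.exists_eq_mul_or hA hx₁ hs₁ hea hb).resolve_right fun ⟨r, hr⟩ => hba r hr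
    set r := η * r₀ with hr_def
    have hr : a = b * r := by rw [hr_def, ← mul_assoc, hbη, hr₀]
    have hηr : η * r = r := by rw [hr_def, ← mul_assoc, hη]
    by_cases hker : p (r • x₀) = 0
    -- Here `a = b * r` with `r • x₀` in the radical of `P₀`. The range of `d` is that radical, so
    -- the radical lies in its own product with `Ring.jacobson A`; Nakayama's lemma kills it and `M`
    -- is projective.
    · apply hM
      rw [h.cover.projective_iff_ker_eq_bot]
      refine Submodule.FG.eq_bot_of_le_jacobson_smul (IsNoetherian.noetherian _) ?_
      rw [← h.range_eq_ker]
      rintro _ ⟨y, rfl⟩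
      have h1 : d y = (s₁ y * b) • r • x₀ := by
        rw [smul_smul, mul_assoc, ← hr, mul_smul, hax, ← map_smul, hs₁]
      rw [h1]
      refine Submodule.smul_mem_smul ((Ring.jacobson A).mul_mem_left _ hbJ) ?_
      rw [h.range_eq_ker]
      exact hker
    · have hspan := h.cover.eq_top_of_mem (Submodule.mem_span_singleton_self (R := A) (r • x₀)) hker
      have hsurj : Function.Surjective (LinearMap.toSpanSingleton A P₀ (r • x₀)) := by
        rw [← LinearMap.range_eq_top, LinearMap.range_toSpanSingleton, hspan]
      have := h.cover.projective
      obtain ⟨u, hu⟩ := Module.projective_lifting_property _ LinearMap.id hsurj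
      set v := u x₀ * η with hv_def
      have hvη : v * η = v := by rw [hv_def, mul_assoc, hη]
      have hvr : (v * r) • x₀ = x₀ := by
        rw [hv_def, mul_assoc, hηr, mul_smul]
        simpa using LinearMap.congr_fun hu x₀
      obtain ⟨z, hz⟩ : ∃ z, z • x₀ = x₀ ∧ z * z = z ∧ ∀ c : A, c • x₀ = 0 → c * z = 0 := by
        refine ⟨s₀ x₀, hs₀ _, ?_, fun c hc => ?_⟩
        · rw [← smul_eq_mul, ← map_smul, hs₀]
        · rw [← smul_eq_mul, ← map_smul, hc, map_zero]
      obtain ⟨hzx, hzz, hzc⟩ := hz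
      set v' := z * v with hv'_def
      have hv'r : v' * r * z = z := by
        have h0 : (v' * r - z) • x₀ = 0 := by
          rw [sub_smul, hv'_def, mul_assoc, mul_smul, hvr, sub_self]
        have := hzc _ h0
        rwa [sub_mul, hzz, sub_eq_zero] at this
      -- `r • x₀` generates `P₀`, so `r` has a one-sided inverse `v'` relative to the idempotent `z`
      -- of `P₀`, and `ρ` is a nonzero idempotent below `η`. Since `b * ρ = a * v'`, removing `ρ`
      -- from `η` keeps `b * (η - ρ)` outside `a A`.
      set ρ := r * v' with hρ_def
      have hzv' : z * v' = v' := by rw [hv'_def, ← mul_assoc, hzz]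
      have hv'η : v' * η = v' := by rw [hv'_def, mul_assoc, hvη]
      have hρρ : ρ * ρ = ρ := by
        calc ρ * ρ = r * (v' * r * z) * v' := by simp only [hρ_def, mul_assoc, hzv']
          _ = ρ := by rw [hv'r, hρ_def, mul_assoc, hzv']
      have hηρ : η * ρ = ρ := by rw [hρ_def, ← mul_assoc, hηr]
      have hρη : ρ * η = ρ := by rw [hρ_def, mul_assoc, hv'η]
      have hρ0 : ρ ≠ 0 := by
        intro h0
        have h2 : z = 0 := by
          calc z = v' * r * (v' * r * z) := by rw [hv'r, hv'r]
            _ = v' * ρ * r * z := by rw [hρ_def]; simp only [mul_assoc]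
            _ = 0 := by rw [h0]; simp
        apply hx₀
        rw [← hzx, h2, zero_smul, map_zero]
      have hidem : (η - ρ) * (η - ρ) = η - ρ := by
        rw [mul_sub, sub_mul, sub_mul, hη, hηρ, hρη, hρρ]
        abel
      refine ih (Submodule.span A {η - ρ}) ?_ (η - ρ) rfl hidem (b * (η - ρ)) ?_ ?_ ?_ ?_
      · refine lt_of_le_of_ne ?_ fun heq => hρ0 ?_
        · rw [Submodule.span_singleton_le_iff_mem]
          refine Submodule.mem_span_singleton.2 ⟨η - ρ, ?_⟩
          rw [smul_eq_mul, sub_mul, hη, hρη]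
        · obtain ⟨c, hc⟩ := Submodule.mem_span_singleton.1
            (heq ▸ Submodule.mem_span_singleton_self (R := A) η : η ∈ Submodule.span A {η - ρ})
          have h3 : η * ρ = 0 := by
            rw [← hc, smul_eq_mul, mul_assoc, sub_mul, hηρ, hρρ, sub_self, mul_zero]
          rw [← hηρ, h3]
      · rw [mul_sub, hbη]
        exact (Ring.jacobson A).sub_mem hbJ (Ideal.mul_mem_right _ _ hbJ)
      · rw [← mul_assoc, hb]
      · rw [mul_assoc, hidem]
      · intro t ht
        apply hba (t + v')
        rw [mul_add, ← ht, mul_sub, hbη, hρ_def, ← mul_assoc b, ← hr]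
        abel
  refine key _ 1 rfl (one_mul 1) (g x₁) hJ (hgx g x₁).symm (mul_one _) fun r hr => ?_
  refine hg (LinearMap.toSpanSingleton A A r ∘ₗ s₀) ?_
  ext y
  rw [LinearMap.comp_apply, LinearMap.comp_apply, LinearMap.toSpanSingleton_apply, smul_eq_mul,
    hgx g y, hr, ← mul_assoc, ha_def]
  congr 1
  rw [← smul_eq_mul, ← map_smul, ← map_smul, hs₁]

end IsMinimalPresentation

end Transpose

/-! ### The dual of a simple right module -/

section Dual

open MulOpposite

variable {k : Type w} [CommRing k] {E : Type w} [AddCommGroup E] [Module k E]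
  {i : (k ⧸ Ring.jacobson k) →ₗ[k] E}

/-- Any two nonzero elements of the injective envelope of `k / rad k` that are killed by the same
maximal ideal are multiples of each other. -/
theorem IsInjectiveEnvelope.exists_smul_eq (hi : IsInjectiveEnvelope i) {m : Ideal k}
    (hm : m.IsMaximal) {y y' : E} (hy : ∀ c ∈ m, c • y = 0) (hy' : ∀ c ∈ m, c • y' = 0)
    (h0 : y ≠ 0) : ∃ c : k, y' = c • y := by
  have hinv : ∀ c ∉ m, ∃ c', c' * c - 1 ∈ m := by
    intro c hc
    obtain ⟨c', z, hz, h⟩ := hm.exists_inv hc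
    refine ⟨c', ?_⟩
    rw [← h, sub_add_cancel_left]
    exact m.neg_mem hz
  have hone : ∀ {M : Type w} [AddCommGroup M] [Module k M] (z : M), (∀ c ∈ m, c • z = 0) →
      ∀ c, c - 1 ∈ m → c • z = z := by
    intro M _ _ z hz c hc
    have := hz _ hc
    rwa [sub_smul, one_smul, sub_eq_zero] at this
  -- By essentiality some nonzero multiple `c • y` lies in the range of `i`. The scalar `c` is
  -- invertible modulo `m`, so `y` itself lies there.
  have hrange : ∀ y : E, (∀ c ∈ m, c • y = 0) → ∃ c : k, y = i (Submodule.Quotient.mk c) := by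
    intro y hy
    by_cases h0 : y = 0
    · exact ⟨0, by rw [h0, Submodule.Quotient.mk_zero, map_zero]⟩
    have hne : Submodule.span k {y} ⊓ LinearMap.range i ≠ ⊥ := fun h => by
      have := hi.essential _ h
      exact h0 (by simpa using this)
    obtain ⟨z, ⟨hz, x, hx⟩, hz0⟩ := Submodule.exists_mem_ne_zero_of_ne_bot hne
    obtain ⟨c, rfl⟩ := Submodule.mem_span_singleton.1 hz
    have hcm : c ∉ m := fun hc => hz0 (hy c hc)
    obtain ⟨c', hc'⟩ := hinv c hcm
    obtain ⟨b, rfl⟩ := Submodule.Quotient.mk_surjective _ x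
    refine ⟨c' * b, ?_⟩
    rw [← smul_eq_mul, Submodule.Quotient.mk_smul, map_smul, hx, smul_smul, hone y hy _ hc']
  obtain ⟨b, rfl⟩ := hrange y hy
  obtain ⟨b', rfl⟩ := hrange y' hy'
  have hmem : ∀ b : k, (∀ c ∈ m, c • i (Submodule.Quotient.mk b) = 0) →
      ∀ c ∈ m, c * b ∈ Ring.jacobson k := by
    intro b hb c hc
    have := hb c hc
    rw [← map_smul, ← Submodule.Quotient.mk_smul] at this
    have h2 := hi.injective (this.trans (map_zero i).symm)
    rwa [Submodule.Quotient.mk_eq_zero] at h2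
  have hbm : b ∉ m := by
    intro hb
    apply h0
    have h1 : b * b ∈ Ring.jacobson k := hmem b hy b hb
    have h2 : b ∈ Ring.jacobson k := by
      rw [Ring.jacobson_eq_sInf_isMaximal, Ideal.mem_sInf] at h1 ⊢
      intro I hI
      have := h1 hI
      exact (Ideal.IsMaximal.isPrime hI).mem_or_mem this |>.elim id id
    rw [(Submodule.Quotient.mk_eq_zero _).2 h2, map_zero]
  obtain ⟨c, hc⟩ := hinv b hbm
  refine ⟨b' * c, ?_⟩
  rw [← map_smul, ← Submodule.Quotient.mk_smul]
  congr 1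
  rw [Submodule.Quotient.eq, smul_eq_mul]
  have := hmem b' hy' _ hc
  have h2 : b' - b' * c * b = -((c * b - 1) * b') := by ring
  rw [h2]
  exact Submodule.neg_mem _ this

/-- The injective envelope of `k / rad k` contains every simple `k`-module. -/
theorem IsInjectiveEnvelope.exists_ne_zero [IsArtinianRing k] (hi : IsInjectiveEnvelope i)
    {m : Ideal k} (hm : m.IsMaximal) : ∃ y : E, y ≠ 0 ∧ ∀ c ∈ m, c • y = 0 := by
  have : IsSemisimpleModule k (k ⧸ Ring.jacobson k) :=
    (IsArtinian.isSemisimpleModule_iff_jacobson k _).2 (Module.jacobson_quotient_jacobson k k)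
  obtain ⟨C, hC⟩ := exists_isCompl (Submodule.map (Submodule.mkQ (Ring.jacobson k)) m)
  have hne : C ≠ ⊥ := by
    rintro rfl
    apply hm.ne_top
    have h1 : Submodule.map (Submodule.mkQ (Ring.jacobson k)) m = ⊤ := by
      simpa using hC.sup_eq_top
    have h2 := congrArg (Submodule.comap (Submodule.mkQ (Ring.jacobson k))) h1
    rw [Submodule.comap_map_mkQ, Submodule.comap_top, sup_eq_right.2] at h2
    · exact h2
    · exact Ring.jacobson_le_of_isMaximal m
  obtain ⟨z, hz, hz0⟩ := Submodule.exists_mem_ne_zero_of_ne_bot hne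
  refine ⟨i z, fun h => hz0 (hi.injective (h.trans (map_zero i).symm)), fun c hc => ?_⟩
  have h1 : c • z ∈ Submodule.map (Submodule.mkQ (Ring.jacobson k)) m ⊓ C := by
    refine ⟨?_, C.smul_mem c hz⟩
    obtain ⟨b, rfl⟩ := Submodule.Quotient.mk_surjective _ z
    exact ⟨c * b, m.mul_mem_right b hc, rfl⟩
  rw [hC.inf_eq_bot, Submodule.mem_bot] at h1
  rw [← map_smul, h1, map_zero]

variable {A X : Type u} [Ring A] [Algebra k A] [AddCommGroup X] [Module k X] [Module Aᵐᵒᵖ X]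
  [IsScalarTower k Aᵐᵒᵖ X]

section Simple

variable {q₀ : X} (h0 : q₀ ≠ 0) (hgen : ∀ q : X, ∃ t : A, op t • q₀ = q)
  (hsimple : ∀ q : X, q ≠ 0 → ∃ t : A, op t • q = q₀)

include hgen

theorem smul_eq_zero_of_generator {c : k} (hc : c • q₀ = 0) (q : X) : c • q = 0 := by
  obtain ⟨t, rfl⟩ := hgen q
  rw [smul_comm, hc, smul_zero]

include h0 hsimple

omit hgen in
-- `k` acts on a simple right module by module endomorphisms, which makes the annihilator of `q₀`
-- prime, and primes of an artinian ring are maximal.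
theorem isMaximal_annihilator [IsArtinianRing k] :
    Ideal.IsMaximal (LinearMap.ker (LinearMap.toSpanSingleton k X q₀)) := by
  have hp : Ideal.IsPrime (LinearMap.ker (LinearMap.toSpanSingleton k X q₀)) := by
    refine ⟨fun h => h0 ?_, fun {c c'} hcc => ?_⟩
    · have : (1 : k) ∈ LinearMap.ker (LinearMap.toSpanSingleton k X q₀) :=
        h ▸ Submodule.mem_top
      simpa using this
    · simp only [LinearMap.mem_ker, LinearMap.toSpanSingleton_apply] at hcc ⊢
      by_contra! hne
      obtain ⟨t, ht⟩ := hsimple _ hne.2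
      apply hne.1
      rw [← ht, smul_comm, smul_smul, hcc, smul_zero]
  exact hp.isMaximal'

omit hgen in
-- The line `k q₀` is `k ⧸ m` with `m` maximal. It embeds in `E`, and injectivity extends the
-- embedding to `X`.
theorem exists_rightDual_apply_ne_zero [IsArtinianRing k] (hi : IsInjectiveEnvelope i) :
    ∃ φ : X →ₗ[k] E, φ q₀ ≠ 0 := by
  obtain ⟨y, hy0, hy⟩ := hi.exists_ne_zero (isMaximal_annihilator (k := k) h0 hsimple)
  have := hi.injective_module
  set m := LinearMap.ker (LinearMap.toSpanSingleton k X q₀) with hm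
  let f : (k ⧸ m) →ₗ[k] X := m.liftQ (LinearMap.toSpanSingleton k X q₀) le_rfl
  have hf : Function.Injective f := by
    rw [← LinearMap.ker_eq_bot]
    exact Submodule.ker_liftQ_eq_bot _ _ _ le_rfl
  let g : (k ⧸ m) →ₗ[k] E := m.liftQ (LinearMap.toSpanSingleton k E y) fun c hc => hy c hc
  obtain ⟨φ, hφ⟩ := Module.Injective.extension_property k E _ _ f hf g
  refine ⟨φ, fun h => hy0 ?_⟩
  have h1 := LinearMap.congr_fun hφ (Submodule.Quotient.mk 1)
  have h2 : f (Submodule.Quotient.mk 1) = q₀ := one_smul k q₀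
  have h3 : g (Submodule.Quotient.mk 1) = y := one_smul k y
  rw [LinearMap.comp_apply, h2, h3, h] at h1
  exact h1.symm

/-- A nonzero submodule `N` of the dual separates the points of `X`, since any nonzero point
generates `X`. All functionals take values in the part of `E` killed by `m`, which is
one-dimensional over `k ⧸ m`, so linear algebra makes a separating subspace everything. -/
theorem isSimpleModule_rightDual [IsArtinianRing k] [Module.Finite k A]
    (hi : IsInjectiveEnvelope i) : IsSimpleModule A (RightDual k A X E) := by
  set m : Ideal k := LinearMap.ker (LinearMap.toSpanSingleton k X q₀) with hm_def
  have hm : m.IsMaximal := isMaximal_annihilator (k := k) h0 hsimple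
  have hmX : ∀ (φ : X →ₗ[k] E) (q : X), ∀ c ∈ m, c • φ q = 0 := fun φ q c hc => by
    have h : c • q₀ = 0 := hc
    rw [← map_smul, smul_eq_zero_of_generator hgen h, map_zero]
  have hart : IsArtinian k X := by
    have : Module.Finite k Aᵐᵒᵖ := Module.Finite.equiv (opLinearEquiv k : A ≃ₗ[k] Aᵐᵒᵖ)
    have h1 : Function.Surjective
        ((LinearMap.toSpanSingleton Aᵐᵒᵖ X q₀).restrictScalars k) := fun q => by
      obtain ⟨t, ht⟩ := hgen q
      exact ⟨op t, ht⟩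
    have := Module.Finite.of_surjective _ h1
    infer_instance
  obtain ⟨φ₀, hφ₀⟩ := exists_rightDual_apply_ne_zero (k := k) h0 hsimple hi
  have hnontriv : Nontrivial (RightDual k A X E) :=
    ⟨⟨φ₀, 0, fun h => hφ₀ (by
      have := LinearMap.congr_fun (show φ₀ = (0 : X →ₗ[k] E) from h) q₀
      simpa using this)⟩⟩
  refine { toNontrivial := ?_, eq_bot_or_eq_top := fun N => ?_ }
  · exact (Submodule.nontrivial_iff A).2 hnontriv
  refine or_iff_not_imp_left.2 fun hN => ?_
  obtain ⟨ψ₀, hψ₀, hψ₀0⟩ := Submodule.exists_mem_ne_zero_of_ne_bot hN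
  have hsmul : ∀ (c : k) (ψ : X →ₗ[k] E), (ψ : RightDual k A X E) ∈ N →
      ((c • ψ : X →ₗ[k] E) : RightDual k A X E) ∈ N := by
    intro c ψ hψ
    have h1 := N.smul_mem (algebraMap k A c) hψ
    have h2 : (algebraMap k A c • (show RightDual k A X E from ψ)) = (c • ψ : X →ₗ[k] E) := by
      apply LinearMap.ext
      intro q
      change ψ (op (algebraMap k A c) • q) = c • ψ q
      rw [← MulOpposite.algebraMap_apply, algebraMap_smul, map_smul]
    rwa [h2] at h1
  have hsep : ∀ q : X, q ≠ 0 → ∃ ψ : X →ₗ[k] E, (ψ : RightDual k A X E) ∈ N ∧ ψ q ≠ 0 := by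
    intro q hq
    by_contra! hall
    apply hψ₀0
    apply LinearMap.ext
    intro q'
    obtain ⟨t, ht⟩ := hsimple q hq
    obtain ⟨t', ht'⟩ := hgen q'
    have := hall _ (N.smul_mem (t * t') hψ₀)
    change (show X →ₗ[k] E from ψ₀) (op (t * t') • q) = 0 at this
    rw [op_mul, mul_smul, ht, ht'] at this
    exact this
  -- The `Y` whose annihilator lies in `N`. A minimal such `Y` is zero: if `ψ` in `N` is nonzero at
  -- `y` in `Y`, subtracting a multiple of `ψ` shows that `Y ⊓ ker ψ` also belongs to `F`.
  let F : Set (Submodule k X) :=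
    {Y | ∀ φ : X →ₗ[k] E, (∀ y ∈ Y, φ y = 0) → (φ : RightDual k A X E) ∈ N}
  have hF : F.Nonempty := ⟨⊤, fun φ hφ => by
    have : φ = 0 := LinearMap.ext fun q => hφ q Submodule.mem_top
    rw [this]
    exact N.zero_mem⟩
  obtain ⟨Y, hYF, hmin⟩ := WellFounded.has_min (r := fun x y : Submodule k X => x < y)
    wellFounded_lt F hF
  have hY : Y = ⊥ := by
    by_contra hne
    obtain ⟨y, hy, hy0⟩ := Submodule.exists_mem_ne_zero_of_ne_bot hne
    obtain ⟨ψ, hψ, hψy⟩ := hsep y hy0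
    have hlin : ∀ e : E, (∀ c ∈ m, c • e = 0) → ∃ c : k, e = c • ψ y := fun e he =>
      hi.exists_smul_eq hm (hmX ψ y) he hψy
    refine hmin (Y ⊓ LinearMap.ker ψ) (fun φ hφ => ?_) (lt_of_le_of_ne inf_le_left fun h => ?_)
    · obtain ⟨c, hc⟩ := hlin (φ y) (hmX φ y)
      have h1 : ((φ - c • ψ : X →ₗ[k] E) : RightDual k A X E) ∈ N := by
        refine hYF _ fun z hz => ?_
        obtain ⟨c', hc'⟩ := hlin (ψ z) (hmX ψ z)
        have h2 : φ (z - c' • y) = 0 := hφ _ ⟨Y.sub_mem hz (Y.smul_mem _ hy), by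
          change ψ (z - c' • y) = 0
          rw [map_sub, map_smul, hc', sub_self]⟩
        rw [map_sub, map_smul, hc, sub_eq_zero] at h2
        rw [LinearMap.sub_apply, LinearMap.smul_apply, h2, hc', smul_comm, sub_self]
      have h3 := N.add_mem h1 (hsmul c ψ hψ)
      have h4 : (φ - c • ψ) + c • ψ = φ := sub_add_cancel _ _
      exact h4 ▸ h3
    · have h5 : y ∈ Y ⊓ LinearMap.ker ψ := by rw [h]; exact hy
      exact hψy h5.2
  rw [eq_top_iff]
  intro φ _
  refine hYF φ fun y hy => ?_
  rw [hY, Submodule.mem_bot] at hy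
  rw [hy]
  exact LinearMap.map_zero (show X →ₗ[k] E from φ)

end Simple

end Dual

/-! ### The Auslander-Reiten translate of a simple module -/

section Translate

open MulOpposite

variable {k : Type w} {A : Type u} [CommRing k] [IsArtinianRing k] [Ring A] [Algebra k A]
  [Module.Finite k A] {n : ℕ} {S P : Fin n → Type u}
  [∀ i, AddCommGroup (S i)] [∀ i, Module A (S i)] [∀ i, AddCommGroup (P i)] [∀ i, Module A (P i)]
  {π : ∀ i, P i →ₗ[A] S i}

/-- For a non-projective simple module `M` over a Nakayama algebra, `D Tr M` is the simple module
whose projective cover is the first term of the minimal projective presentation of `M`. -/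
theorem IsMinimalPresentation.nonempty_rightDual_transpose_equiv (hA : IsNakayama A)
    {P₁ P₀ M S' : Type u} [AddCommGroup P₁] [Module A P₁] [AddCommGroup P₀] [Module A P₀]
    [AddCommGroup M] [Module A M] [AddCommGroup S'] [Module A S'] {d : P₁ →ₗ[A] P₀}
    {p : P₀ →ₗ[A] M} [IsSimpleModule A M] [IsSimpleModule A S']
    (h : IsMinimalPresentation d p) (hM : ¬ Module.Projective A M)
    {q : LinearMap.ker p →ₗ[A] S'} (hq : Function.Surjective q)
    {E : Type w} [AddCommGroup E] [Module k E] {i : (k ⧸ Ring.jacobson k) →ₗ[k] E}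
    (hi : IsInjectiveEnvelope i) :
    Nonempty (RightDual k A (Transpose d) E ≃ₗ[A] S') := by
  have : IsArtinianRing A := IsArtinianRing.of_finite k A
  have hπ' := h.isProjectiveCover_comp hA.left hq
  obtain ⟨x₁, s₁, hx₁, hs₁⟩ := hπ'.exists_generator
  have hgx : ∀ (g : P₁ →ₗ[A] A) y, g y = s₁ y * g x₁ := fun g y => by
    rw [← smul_eq_mul, ← map_smul, hs₁]
  let q₀ : Transpose d := Submodule.Quotient.mk s₁
  have hzero : ∀ g : P₁ →ₗ[A] A, (Submodule.Quotient.mk g : Transpose d) = 0 ↔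
      ∃ f : P₀ →ₗ[A] A, f ∘ₗ d = g := fun g => by
    rw [Submodule.Quotient.mk_eq_zero]
    rfl
  have h0 : q₀ ≠ 0 := fun h0 => by
    obtain ⟨f, hf⟩ := (hzero s₁).1 h0
    exact h.section_ne_comp hx₁ hs₁ f hf
  have hop : ∀ t, ∀ g : P₁ →ₗ[A] A, (∀ y, g y = s₁ y * t) →
      op t • q₀ = Submodule.Quotient.mk g := fun t g hg => by
    rw [← Submodule.Quotient.mk_smul]
    congr 1
    ext y
    exact (hg y).symm
  have hgen : ∀ q : Transpose d, ∃ t : A, op t • q₀ = q := fun q => by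
    obtain ⟨g, rfl⟩ := Submodule.Quotient.mk_surjective _ q
    exact ⟨g x₁, hop _ _ (hgx g)⟩
  have hsimple : ∀ q : Transpose d, q ≠ 0 → ∃ t : A, op t • q = q₀ := fun q hq => by
    obtain ⟨g, rfl⟩ := Submodule.Quotient.mk_surjective _ q
    obtain ⟨t, ht⟩ := h.exists_mul_eq hM hA.right hπ' hx₁ hs₁ (g := g) fun f hf =>
      hq ((hzero g).2 ⟨f, hf⟩)
    refine ⟨t, ?_⟩
    rw [← Submodule.Quotient.mk_smul]
    congr 1
    ext y
    change g y * t = s₁ y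
    rw [hgx g y, mul_assoc, ← ht, ← hgx s₁ y]
  have := isSimpleModule_rightDual (k := k) h0 hgen hsimple hi
  obtain ⟨φ, hφ⟩ := exists_rightDual_apply_ne_zero (k := k) h0 hsimple hi
  -- The idempotent `s₁ x₁` fixes `q₀`, so it does not kill `φ`, and `P₁` maps nontrivially to the
  -- simple dual.
  refine hπ'.nonempty_equiv_of_ne_zero (f := LinearMap.toSpanSingleton A
    (RightDual k A (Transpose d) E) φ ∘ₗ s₁) fun hf => hφ ?_
  have h1 := LinearMap.congr_fun hf x₁
  have h2 := LinearMap.congr_fun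
    (show (show Transpose d →ₗ[k] E from s₁ x₁ • (show RightDual k A (Transpose d) E from φ)) = 0
      from h1) q₀
  rw [rightDual_smul_apply, hop _ s₁ (hgx s₁)] at h2
  exact h2

/-- For a non-projective simple module `S a`, its translate is the simple module that succeeds it in
the quiver. -/
theorem isARTranslate_iff (hS : IsCompleteFamilyOfSimples A S)
    (hπ : ∀ i, IsProjectiveCover (π i)) (hA : IsNakayama A) {a b : Fin n} (h : IsSuccessor π a b)
    {M T : Type u} [AddCommGroup M] [Module A M] [AddCommGroup T] [Module A T]
    (e : M ≃ₗ[A] S a) : IsARTranslate k A M T ↔ Nonempty (T ≃ₗ[A] S b) := by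
  have : IsArtinianRing A := IsArtinianRing.of_finite k A
  have := hS.simple
  have : IsSimpleModule A M := IsSimpleModule.congr e
  have hker := ker_ne_bot_of_isSuccessor hS h
  have hM : ¬ Module.Projective A M := fun hM =>
    hker ((hπ a).projective_iff_ker_eq_bot.1 (Module.Projective.of_equiv e))
  have key : ∀ {P₁ P₀ : Type u} [AddCommGroup P₁] [Module A P₁] [AddCommGroup P₀] [Module A P₀]
      {d : P₁ →ₗ[A] P₀} {p : P₀ →ₗ[A] M} {E : Type w} [AddCommGroup E] [Module k E]
      {i : (k ⧸ Ring.jacobson k) →ₗ[k] E}, IsMinimalPresentation d p → IsInjectiveEnvelope i →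
      Nonempty (RightDual k A (Transpose d) E ≃ₗ[A] S b) := by
    intro P₁ P₀ _ _ _ _ d p E _ _ i hd hi
    have := hd.cover.finite
    have : Nontrivial (LinearMap.ker p) := Submodule.nontrivial_iff_ne_bot.2 fun h0 =>
      hM (hd.cover.projective_iff_ker_eq_bot.2 h0)
    obtain ⟨c, q, hq⟩ := exists_surjective_to_simple hS (M := LinearMap.ker p)
    have := (hπ a).projective
    -- Comparing covers carries rad `P a` onto `ker p`, so every simple quotient of `ker p` is a
    -- successor of `a`, hence equal to `S b`.
    obtain ⟨u, hu⟩ := Module.projective_lifting_property p (e.symm.toLinearMap ∘ₗ π a)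
      hd.cover.surjective
    have hpu : ∀ x, p (u x) = e.symm (π a x) := fun x => LinearMap.congr_fun hu x
    have husurj : Function.Surjective u := by
      obtain ⟨x, hx⟩ := (hπ a).exists_ne_zero
      rw [← LinearMap.range_eq_top]
      refine hd.cover.eq_top_of_mem (x := u x) ⟨x, rfl⟩ ?_
      rw [hpu]
      simpa using hx
    have hmem : ∀ x : LinearMap.ker (π a), u x ∈ LinearMap.ker p := fun x => by
      rw [LinearMap.mem_ker, hpu, LinearMap.mem_ker.1 x.2, map_zero]
    have hc : IsSuccessor π a c := by
      refine ⟨q ∘ₗ (u ∘ₗ (LinearMap.ker (π a)).subtype).codRestrict (LinearMap.ker p) hmem,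
        hq.comp fun y => ?_⟩
      obtain ⟨x, hx⟩ := husurj y
      refine ⟨⟨x, ?_⟩, Subtype.ext hx⟩
      have := hpu x
      rw [hx, LinearMap.mem_ker.1 y.2] at this
      simpa using this.symm
    obtain rfl := isSuccessor_unique hS hπ hA.left hc h
    exact hd.nonempty_rightDual_transpose_equiv hA hM hq hi
  constructor
  · rintro ⟨P₁, P₀, _, _, _, _, d, p, E, _, _, i, hd, hi, ⟨f⟩⟩
    obtain ⟨f'⟩ := key hd hi
    exact ⟨f.trans f'⟩
  · rintro ⟨f⟩
    obtain ⟨g, hg⟩ := exists_surjective_of_isSuccessor hS hπ hA.left h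
    obtain ⟨E, _, _, i, hi⟩ := exists_isInjectiveEnvelope (R := k) (k ⧸ Ring.jacobson k)
    have hkp : LinearMap.ker (e.symm.toLinearMap ∘ₗ π a) = LinearMap.ker (π a) := by
      ext x
      simp
    have hmem : ∀ x, ((LinearMap.ker (π a)).subtype ∘ₗ g) x ∈
        LinearMap.ker (e.symm.toLinearMap ∘ₗ π a) := fun x => by
      rw [hkp]
      exact (g x).2
    have hd : IsMinimalPresentation ((LinearMap.ker (π a)).subtype ∘ₗ g)
        (e.symm.toLinearMap ∘ₗ π a) := by
      refine ⟨⟨(hπ a).projective, e.symm.surjective.comp (hπ a).surjective, fun N hN =>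
        (hπ a).superfluous N (hkp ▸ hN)⟩, hmem, ⟨(hπ b).projective, ?_, fun N hN => ?_⟩⟩
      · rintro ⟨y, hy⟩
        obtain ⟨x, hx⟩ := hg ⟨y, hkp ▸ hy⟩
        have h1 : ((g x : LinearMap.ker (π a)) : P a) = y := congrArg Subtype.val hx
        exact ⟨x, Subtype.ext h1⟩
      · by_contra hne
        apply (hπ b).isCoatom_ker.1
        rw [eq_top_iff, ← hN]
        refine sup_le ((hπ b).le_ker hne) ((hπ b).le_ker fun h0 => ?_)
        apply hker
        rw [Submodule.eq_bot_iff]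
        intro y hy
        obtain ⟨x, hx⟩ := hg ⟨y, hy⟩
        have h1 : x ∈ (⊤ : Submodule A (P b)) := Submodule.mem_top
        rw [← h0] at h1
        have h2 := congrArg Subtype.val (LinearMap.mem_ker.1 h1)
        have h3 : ((g x : LinearMap.ker (π a)) : P a) = 0 := h2
        rwa [hx] at h3
    obtain ⟨f'⟩ := key hd hi
    exact ⟨_, _, _, _, _, _, _, _, E, _, _, i, hd, hi, ⟨f.trans f'.symm⟩⟩

end Translate

/-! ### The resolution quiver -/

section Resolution

variable {k : Type w} {A : Type u} [CommRing k] [IsArtinianRing k] [Ring A] [Algebra k A]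
  [Module.Finite k A] {n : ℕ} {S P : Fin n → Type u}
  [∀ i, AddCommGroup (S i)] [∀ i, Module A (S i)] [∀ i, AddCommGroup (P i)] [∀ i, Module A (P i)]
  {π : ∀ i, P i →ₗ[A] S i}

/-- For non-projective `S a` this is the translate computation. For projective `S a`, the vertex `σ
a` is nobody's successor, which characterises the injective simple module. -/
theorem isTauTilde_iff (hS : IsCompleteFamilyOfSimples A S) (hπ : ∀ i, IsProjectiveCover (π i))
    (hconn : IsConnected A) (hA : IsNakayama A) {σ : Equiv.Perm (Fin n)}
    (hσ : ∀ a, LinearMap.ker (π a) ≠ ⊥ → IsSuccessor π a (σ a)) {a j : Fin n} {M : Type u}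
    [AddCommGroup M] [Module A M] (e : M ≃ₗ[A] S a) :
    IsTauTilde k A M (S j) ↔ σ a = j := by
  have : IsArtinianRing A := IsArtinianRing.of_finite k A
  have := hS.simple
  have hproj : Module.Projective A M ↔ LinearMap.ker (π a) = ⊥ := by
    rw [← (hπ a).projective_iff_ker_eq_bot]
    exact ⟨fun _ => Module.Projective.of_equiv e, fun _ => Module.Projective.of_equiv e.symm⟩
  unfold IsTauTilde
  rw [hproj]
  by_cases ha : LinearMap.ker (π a) = ⊥
  · simp only [ha, not_true_eq_false, false_and, true_and, false_or]
    constructor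
    · intro hj
      exact apply_eq_of_ker_eq_bot hS hπ hconn hA hσ ha (not_isSuccessor_of_injective hS hπ hj)
    · rintro rfl
      refine injective_of_forall_not_isSuccessor hS hπ fun c hc => ?_
      have hc' := ker_ne_bot_of_isSuccessor hS hc
      have := σ.injective (isSuccessor_unique hS hπ hA.left (hσ c hc') hc)
      exact hc' (this ▸ ha)
  · simp only [ha, not_false_eq_true, false_and, true_and, or_false]
    rw [isARTranslate_iff hS hπ hA (hσ a ha) e]
    constructor
    · rintro ⟨f⟩
      exact (hS.pairwise _ _ ⟨f⟩).symm
    · rintro rfl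
      exact ⟨LinearEquiv.refl A _⟩

/-- The resolution quiver is the functional graph of the map that shifts a vertex along the cyclic
order by the length of its projective cover. -/
theorem arrow_iff (hS : IsCompleteFamilyOfSimples A S) (hπ : ∀ i, IsProjectiveCover (π i))
    (hconn : IsConnected A) (hA : IsNakayama A) {σ : Equiv.Perm (Fin n)}
    (hσ : ∀ a, LinearMap.ker (π a) ≠ ⊥ → IsSuccessor π a (σ a)) (i j : Fin n) :
    Arrow k A S P i j ↔ kupischMap σ (fun i => (Module.length A (P i)).toNat) i = j := by
  have : IsArtinianRing A := IsArtinianRing.of_finite k A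
  obtain ⟨e⟩ := nonempty_socle_equiv hS hπ hσ hA.left i
  have hlen := one_le_length hS hπ i
  -- The socle sits at exponent `c i - 1`, and τ̃ supplies the last application of `σ`.
  rw [Arrow, isTauTilde_iff hS hπ hconn hA hσ e, kupischMap, ← Equiv.Perm.mul_apply, ← pow_succ',
    Nat.sub_add_cancel hlen]

end Resolution

end

end NakayamaAlgebra

/-! ### The theorem for connected Nakayama algebras -/

theorem mainTheorem4 {k : Type w} {A : Type u} [CommRing k] [IsArtinianRing k] [Ring A]
    [Algebra k A] [Module.Finite k A] (hconn : NakayamaAlgebra.IsConnected A) (hNak : IsNakayama A)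
    {n : ℕ} (S P : Fin n → Type u)
    [∀ i, AddCommGroup (S i)] [∀ i, Module A (S i)]
    [∀ i, AddCommGroup (P i)] [∀ i, Module A (P i)]
    (hS : IsCompleteFamilyOfSimples A S)
    (π : ∀ i, P i →ₗ[A] S i) (hπ : ∀ i, IsProjectiveCover (π i)) :
    ∃ w : ℕ,
      (cycles k A S P).Nonempty ∧
      (∀ c ∈ cycles k A S P, weight A P c = w) ∧
      (∀ (K : Type v) [Field K] [CharZero K],
        IsMaximalIndependentIn K
          (fun c : cycles k A S P => indicatorVector K (c : Cycle (Fin n)).toFinset)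
          {ξ : Fin n → K | (cartanMatrix A S P).map (Nat.cast : ℕ → K) *ᵥ ξ = fun _ => (w : K)}) ∧
      {ξ : Fin n → ℕ | cartanMatrix A S P *ᵥ ξ = fun _ => w} =
        (fun c : Cycle (Fin n) => indicatorVector ℕ c.toFinset) '' cycles k A S P ∧
      (∀ (K : Type v) [Field K] [CharZero K],
        IsMaximalIndependentIn K
          (fun c : blackCycles k A S P => indicatorVector K (c : Cycle (Fin n)).toFinset)
          {ξ : Fin n → K |
            ((cartanMatrix A S P)ᵀ.map (Nat.cast : ℕ → K) *ᵥ ξ = fun _ => (w : K)) ∧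
            ((cartanMatrix A S P).map (Nat.cast : ℕ → K) *ᵥ ξ = fun _ => (w : K))}) := by
  have : IsArtinianRing A := IsArtinianRing.of_finite k A
  have := hconn.nontrivial
  obtain ⟨σ, hσ⟩ := exists_perm_isSuccessor hS hπ hNak
  have hcyc : cycles k A S P =
      functionalCycles (kupischMap σ fun i => (Module.length A (P i)).toNat) := by
    have harrow : Arrow k A S P =
        fun i j => kupischMap σ (fun i => (Module.length A (P i)).toNat) i = j := by
      funext i j
      exact propext (arrow_iff hS hπ hconn hNak hσ i j)
    rw [cycles, functionalCycles, harrow]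
  have hblack : blackCycles k A S P = {C | C ∈ cycles k A S P ∧ ∀ i ∈ C,
      (Module.length A (P i)).toNat ≠ (Module.length A (P (σ i))).toNat + 1} := by
    simp only [blackCycles, ne_eq, projectiveDimension_eq_one_iff hS hπ hσ hNak.left]
  rw [cartanMatrix_eq_kupischMatrix hS hπ hσ hNak.left]
  exact kupisch_cycles_and_solutions (pos_of_isCompleteFamilyOfSimples hS)
    (sameCycle_of_isConnected hS hπ hconn hNak.left hσ) (one_le_length hS hπ)
    (length_le_length_apply_add_one hS hπ hσ hNak.left) hcyc hblack
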